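/- **Setting.** Let $A$ be a set of actions with a distinguished element $\surd\in A$ (successful termination). Let $P_{\mathrm{PA}^\circlearrowleft}$ be the probabilistic process algebra over $A$ given by the following operators and transition rules, where $a,b$ range over $A$, $\delta(t)$ is the Dirac distribution, $f(\mu,\nu)$ is the product distribution on terms $f(\cdot,\cdot)$, and $\mu\oplus_p\nu = p\mu+(1-p)\nu$ with $p\in(0,1)$: * $0$ (no rules); $\varepsilon\xrightarrow{\surd}\delta(0)$; $b.\bigoplus_{i=1}^n[p_i]x_i\xrightarrow{b}\sum_i p_i\delta(x_i)$ (with $p_i\in(0,1]$, $\sum_i p_i=1$); * sequential composition $x;y$ ($x\xrightarrow{a}\mu$, $a\ne\surd$ gives $x;y\xrightarrow{a}\mu;\delta(y)$; $x\xrightarrow{\surd}\mu$ and $y\xrightarrow{a}\nu$ give $x;y\xrightarrow{a}\nu$) and asynchronous parallel composition $x\,|||\,y$ ($x\xrightarrow{a}\mu$, $a\neq\surd$ gives $x\,|||\,y\xrightarrow{a}\mu\,|||\,\delta(y)$; $y\xrightarrow{a}\nu$, $a\ne\surd$ gives $x\,|||\,y\xrightarrow{a}\delta(x)\,|||\,\nu$;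 $x\xrightarrow{\surd}\mu$ and $y\xrightarrow{\surd}\nu$ give $x\,|||\,y\xrightarrow{\surd}\delta(0)$); * alternative composition ($x\xrightarrow{a}\mu$ gives $x+y\xrightarrow{a}\mu$; $y\xrightarrow{a}\nu$ gives $x+y\xrightarrow{a}\nu$) and probabilistic alternative composition ($x+_py\xrightarrow{a}\mu$ if $x\xrightarrow{a}\mu$, $y\not\xrightarrow{a}$; $x+_py\xrightarrow{a}\nu$ if $x\not\xrightarrow{a}$, $y\xrightarrow{a}\nu$; $x+_py\xrightarrow{a}\mu\oplus_p\nu$ if $x\xrightarrow{a}\mu$, $y\xrightarrow{a}\nu$); * synchronous parallel composition ($x\,|\,y\xrightarrow{a}\mu\,|\,\nu$ if $x\xrightarrow{a}\mu$, $y\xrightarrow{a}\nu$, $a\ne\surd$), CSP-like parallel composition for $B\subseteq A$ ($x\|_By\xrightarrow{a}\mu\|_B\nu$ if $x\xrightarrow{a}\mu$, $y\xrightarrow{a}\nu$, $a\in B\setminus\{\surd\}$; $x\|_By\xrightarrow{a}\mu\|_B\delta(y)$ if $x\xrightarrow{a}\mu$, $a\notin B\cup\{\surd\}$; $x\|_By\xrightarrow{a}\delta(x)\|_B\nu$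 if $y\xrightarrow{a}\nu$, $a\notin B\cup\{\surd\}$) and probabilistic parallel composition (for $a\neq\surd$: $x\,|||_p\,y\xrightarrow{a}\mu\,|||_p\,\delta(y)$ if $x\xrightarrow{a}\mu$, $y\not\xrightarrow{a}$; $x\,|||_p\,y\xrightarrow{a}\delta(x)\,|||_p\,\nu$ if $x\not\xrightarrow{a}$, $y\xrightarrow{a}\nu$; $x\,|||_p\,y\xrightarrow{a}(\mu\,|||_p\,\delta(y))\oplus_p(\delta(x)\,|||_p\,\nu)$ if $x\xrightarrow{a}\mu$, $y\xrightarrow{a}\nu$); each of these three also has a $\surd$-transition to $\delta(0)$ whenever $x\xrightarrow{\surd}\mu$ and $y\xrightarrow{\surd}\nu$; * finite iteration $x^n$, $n\in\mathbb N$: $x^0\xrightarrow{\surd}\delta(0)$; $x\xrightarrow{a}\mu$, $a\ne\surd$ gives $x^{n+1}\xrightarrow{a}\mu;\delta(x^n)$; $x\xrightarrow{\surd}\mu$ gives $x^{n+1}\xrightarrow{\surd}\mu$; $x\xrightarrow{\surd}\mu$, $x\xrightarrow{a}\nu$, $a\ne\surd$, $m<n$ give $x^n\xrightarrow{a}\nu;\delta(x^m)$;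 * finite replication $!^nx$, $n\in\mathbb N$: $!^0x\xrightarrow{\surd}\delta(0)$; $x\xrightarrow{a}\mu$, $a\ne\surd$ gives $!^{n+1}x\xrightarrow{a}\mu\,|||\,\delta(!^nx)$; $x\xrightarrow{\surd}\mu$ gives $!^{n+1}x\xrightarrow{\surd}\mu$; * probabilistic bang $!_px$, $p\in(0,1)$: $x\xrightarrow{a}\mu$, $a\ne\surd$ gives $!_px\xrightarrow{a}\mu\oplus_p(\mu\,|||\,\delta(!_px))$; * infinite iteration ($x^\omega\xrightarrow{a}\mu;\delta(x^\omega)$ if $x\xrightarrow{a}\mu$, $a\neq\surd$), bang ($!x\xrightarrow{a}\mu\,|||\,\delta(!x)$ if $x\xrightarrow{a}\mu$, $a\ne\surd$), Kleene star ($x^*y\xrightarrow{a}\mu;\delta(x^*y)$ if $x\xrightarrow{a}\mu$, $a\ne\surd$; $x^*y\xrightarrow{a}\nu$ if $y\xrightarrow{a}\nu$) and probabilistic Kleene star (for $a\ne\surd$: $x^{*_p}y\xrightarrow{a}\nu\oplus_p(\mu;\delta(x^{*_p}y))$ if $x\xrightarrow{a}\mu$, $y\xrightarrow{a}\nu$;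 $x^{*_p}y\xrightarrow{a}\mu;\delta(x^{*_p}y)$ if $x\xrightarrow{a}\mu$, $y\not\xrightarrow{a}$; $x^{*_p}y\xrightarrow{a}\nu$ if $x\not\xrightarrow{a}$, $y\xrightarrow{a}\nu$; and $x^{*_p}y\xrightarrow{\surd}\nu$ if $y\xrightarrow{\surd}\nu$). Let $P=(\Sigma,A,R)$ be any specification in probabilistic GSOS format (with finitely many rules for each operator and each conclusion label) that is a disjoint extension of $P_{\mathrm{PA}^\circlearrowleft}$, i.e. it contains the operators and rules of $P_{\mathrm{PA}^\circlearrowleft}$ and no further rules for these operators. Its unique supported model is a probabilistic transition system on the set $\mathsf T(\Sigma)$ of closed terms. For $\lambda\in(0,1]$, a $1$-bounded pseudometric $d$ on $\mathsf T(\Sigma)$ is a *$\lambda$-bisimulation metric* if, whenever $d(t,t')<1$ and $t\xrightarrow{a}\pi$, there is $t'\xrightarrow{a}\pi'$ with $\lambda\cdot\mathbf K(d)(\pi,\pi')\le d(t,t')$, where $\mathbf K(d)$ is the Kantorovich lifting of $d$ to distributions. The *$\lambda$-bisimilarity metric* $\mathbf d$ is the (pointwise) smallest $\lambda$-bisimulation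 metric. An $r$-ary operator $f$ is *$K$-Lipschitz continuous* w.r.t. $\mathbf d$, for a real $K\ge 0$, if $\mathbf d(f(s_1,\dots,s_r),f(t_1,\dots,t_r))\le K\sum_{i=1}^r\mathbf d(s_i,t_i)$ for all closed terms $s_i,t_i$. **Theorem.** For every $\lambda\in(0,1]$ (including the non-discounted case $\lambda=1$), the $\lambda$-bisimilarity metric $\mathbf d$ exists, and with respect to $\mathbf d$ 1. finite iteration $\_^n$ is Lipschitz continuous with Lipschitz factor $n$, for every $n\in\mathbb N$; 2. finite replication $!^n\_$ is Lipschitz continuous with Lipschitz factor $n$, for every $n\in\mathbb N$; 3. the probabilistic bang $!_p\_$ is Lipschitz continuous with Lipschitz factor $\dfrac{1}{1-(1-p)\lambda}$, for every $p\in(0,1)$. -/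

import Mathlib

universe u v

/-! ## Signatures, state terms and distribution terms -/

/-- A signature: operators sorted by their rank (`S.Op n` is the set of `n`-ary operators). -/
structure Signature where
  Op : ℕ → Type u

/-- State terms over a signature `S` and a set `V` of state variables. -/
inductive Term (S : Signature.{u}) (V : Type) : Type u
  | var (x : V) : Term S V
  | app {n : ℕ} (f : S.Op n) (ts : Fin n → Term S V) : Term S V

/-- Closed state terms, i.e. processes. -/
abbrev CTerm (S : Signature.{u}) : Type u := Term S Empty

/-- Closed instances of state terms. -/
def Term.subst {S : Signature.{u}} {V : Type} (σ : V → CTerm S) : Term S V → CTerm S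
  | .var x => σ x
  | .app f ts => .app f (fun i => (ts i).subst σ)

/-- Distribution terms over state variables `Vs` and distribution variables `Vd`. In `conv`, the
family `p` consists of positive weights with sum `1`, over a finite or infinite index set `I`. -/
inductive DTerm (S : Signature.{u}) (Vs Vd : Type) : Type (max u 1)
  | var (μ : Vd) : DTerm S Vs Vd
  | dirac (t : Term S Vs) : DTerm S Vs Vd
  | conv {I : Type} (p : PMF I) (hp : ∀ i, p i ≠ 0) (θ : I → DTerm S Vs Vd) : DTerm S Vs Vd
  | app {n : ℕ} (f : S.Op n) (θs : Fin n → DTerm S Vs Vd) : DTerm S Vs Vd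

/-- The product of finitely many probability distributions. -/
noncomputable def prodPMF {X : Type u} : {n : ℕ} → (Fin n → PMF X) → PMF (Fin n → X)
  | 0, _ => PMF.pure Fin.elim0
  | _ + 1, π => (π 0).bind fun x =>
      (prodPMF fun i => π i.succ).map fun xs => (Fin.cons x xs : Fin _ → X)

theorem prodPMF_apply {X : Type u} {n : ℕ} (π : Fin n → PMF X) (x : Fin n → X) :
    prodPMF π x = ∏ i, π i (x i) := by
  classical
  induction n with
  | zero => simp [prodPMF, Subsingleton.elim x Fin.elim0]
  | succ n ih =>
    rw [prodPMF, PMF.bind_apply, tsum_eq_single (x 0), PMF.map_apply, tsum_eq_single (Fin.tail x)]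
    · simp [ih, Fin.prod_univ_succ, Fin.tail]
    · intro y hy
      rw [if_neg]
      rintro h
      exact hy (by rw [h, Fin.tail_cons])
    · intro y hy
      rw [PMF.map_apply, ENNReal.tsum_eq_zero.2, mul_zero]
      intro z
      rw [if_neg]
      rintro h
      exact hy (by rw [h, Fin.cons_zero])

/-- The distribution `f(π₁,…,πₙ)`. -/
noncomputable def opPMF {S : Signature.{u}} {n : ℕ} (f : S.Op n) (π : Fin n → PMF (CTerm S)) :
    PMF (CTerm S) :=
  (prodPMF π).map (Term.app f)

/-- The distribution denoted by a distribution term, under an assignment of processes to the state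
variables and of distributions to the distribution variables. -/
noncomputable def DTerm.eval {S : Signature.{u}} {Vs Vd : Type} (σ : Vs → CTerm S)
    (ρ : Vd → PMF (CTerm S)) : DTerm S Vs Vd → PMF (CTerm S)
  | .var μ => ρ μ
  | .dirac t => PMF.pure (t.subst σ)
  | .conv p _ θ => p.bind fun i => (θ i).eval σ ρ
  | .app f θs => opPMF f fun i => (θs i).eval σ ρ

/-! ## Specifications in probabilistic GSOS format -/

/-- The premises and the target of a PGSOS rule for an `n`-ary operator with source variables
`x₀,…,xₙ₋₁`. The positive premises are `x_(posVar j) —posAct j→ μⱼ` for `j < numPos`, with pairwise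
different distribution variables `μⱼ`; the negative premises are `xᵢ —b↛` for `(i, b) ∈ neg`. The
target contains no variables but the `xᵢ` and the `μⱼ`. -/
structure Rule (S : Signature.{u}) (A : Type v) (n : ℕ) where
  numPos : ℕ
  posVar : Fin numPos → Fin n
  posAct : Fin numPos → A
  neg : Finset (Fin n × A)
  target : DTerm S (Fin n) (Fin numPos)

/-- A probabilistic transition system specification: `rules f a` is the set of rules whose
conclusion has the form `f(x₀,…,xₙ₋₁) —a→ θ`; each of these sets is finite. -/
structure PTSS (S : Signature.{u}) (A : Type v) where
  rules : {n : ℕ} → S.Op n → A → Set (Rule S A n)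
  finite_rules : ∀ {n : ℕ} (f : S.Op n) (a : A), (rules f a).Finite

/-- `Supports P T t a π`: the transition `t —a→ π` is the conclusion of a closed instance of a rule
of `P` whose premises hold in the transition relation `T`. -/
def PTSS.Supports {S : Signature.{u}} {A : Type v} (P : PTSS S A)
    (T : CTerm S → A → PMF (CTerm S) → Prop)
    (t : CTerm S) (a : A) (π : PMF (CTerm S)) : Prop :=
  ∃ (n : ℕ) (f : S.Op n), ∃ r ∈ P.rules f a,
    ∃ (σ : Fin n → CTerm S) (ρ : Fin r.numPos → PMF (CTerm S)),
      (∀ j, T (σ (r.posVar j)) (r.posAct j) (ρ j)) ∧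
      (∀ q ∈ r.neg, ∀ π', ¬ T (σ q.1) q.2 π') ∧
      t = .app f σ ∧ π = r.target.eval σ ρ

/-- `T` contains all and only those transitions that are justified by the rules of `P`. -/
def PTSS.IsSupportedModel {S : Signature.{u}} {A : Type v} (P : PTSS S A)
    (T : CTerm S → A → PMF (CTerm S) → Prop) : Prop :=
  ∀ t a π, T t a π ↔ P.Supports T t a π

/-- The induced model of `P`, by recursion on the source of the transitions; by
`PTSS.isSupportedModel_iff` it is the only supported model of `P`. -/
def PTSS.inducedModel {S : Signature.{u}} {A : Type v} (P : PTSS S A) :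
    CTerm S → A → PMF (CTerm S) → Prop
  | .app f ts, a, π => ∃ r ∈ P.rules f a, ∃ ρ : Fin r.numPos → PMF (CTerm S),
      (∀ j, P.inducedModel (ts (r.posVar j)) (r.posAct j) (ρ j)) ∧
      (∀ q ∈ r.neg, ∀ π', ¬ P.inducedModel (ts q.1) q.2 π') ∧
      π = r.target.eval ts ρ

theorem PTSS.isSupportedModel_iff {S : Signature.{u}} {A : Type v} (P : PTSS S A)
    (T : CTerm S → A → PMF (CTerm S) → Prop) : P.IsSupportedModel T ↔ T = P.inducedModel := by
  constructor
  · intro h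
    funext t
    induction t with
    | var x => exact x.elim
    | app f ts ih =>
      funext a π
      rw [PTSS.inducedModel, eq_iff_iff, h]
      constructor
      · rintro ⟨n, f', r, hr, σ, ρ, h1, h2, h3, h4⟩
        cases h3
        exact ⟨r, hr, ρ, fun j => ih _ ▸ h1 j, fun q hq π' => ih q.1 ▸ h2 q hq π', h4⟩
      · rintro ⟨r, hr, ρ, h1, h2, h4⟩
        exact ⟨_, f, r, hr, ts, ρ, fun j => (ih _).symm ▸ h1 j,
          fun q hq π' => (ih q.1).symm ▸ h2 q hq π', rfl, h4⟩
  · rintro rfl t a π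
    cases t with
    | var x => exact x.elim
    | app f ts =>
      rw [PTSS.inducedModel]
      constructor
      · rintro ⟨r, hr, ρ, h1, h2, h4⟩
        exact ⟨_, f, r, hr, ts, ρ, h1, h2, rfl, h4⟩
      · rintro ⟨n, f', r, hr, σ, ρ, h1, h2, h3, h4⟩
        cases h3
        exact ⟨r, hr, ρ, h1, h2, h4⟩

/-! ## Disjoint extensions -/

/-- An inclusion of signatures: an injective, rank-preserving map of operators. -/
structure SigInclusion (S : Signature.{u}) (S' : Signature.{v}) where
  map : {n : ℕ} → S.Op n → S'.Op n
  injective : ∀ n : ℕ, Function.Injective (map : S.Op n → S'.Op n)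

def Term.lift {S : Signature.{u}} {S' : Signature.{v}} (ι : SigInclusion S S') {V : Type} :
    Term S V → Term S' V
  | .var x => .var x
  | .app f ts => .app (ι.map f) fun i => (ts i).lift ι

noncomputable def DTerm.lift {S : Signature.{u}} {S' : Signature.{v}} (ι : SigInclusion S S')
    {Vs Vd : Type} : DTerm S Vs Vd → DTerm S' Vs Vd
  | .var μ => .var μ
  | .dirac t => .dirac (t.lift ι)
  | .conv p hp θ => .conv p hp fun i => (θ i).lift ι
  | .app f θs => .app (ι.map f) fun i => (θs i).lift ι

noncomputable def Rule.lift {S : Signature.{u}} {S' : Signature.{v}} (ι : SigInclusion S S')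
    {A : Type*} {n : ℕ} (r : Rule S A n) : Rule S' A n where
  numPos := r.numPos
  posVar := r.posVar
  posAct := r.posAct
  neg := r.neg
  target := r.target.lift ι

/-- `P'` is a disjoint extension of `P` along `ι`: it contains the rules of `P` and has no other
rules for the operators of `P`. -/
def IsDisjointExtension {S : Signature.{u}} {S' : Signature.{v}} {A : Type*}
    (ι : SigInclusion S S') (P : PTSS S A) (P' : PTSS S' A) : Prop :=
  ∀ (n : ℕ) (f : S.Op n) (a : A), P'.rules (ι.map f) a = Rule.lift ι '' P.rules f a

/-! ## Bisimulation metrics -/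

structure IsOneBoundedPseudometric {X : Type u} (d : X → X → ℝ) : Prop where
  nonneg : ∀ x y, 0 ≤ d x y
  le_one : ∀ x y, d x y ≤ 1
  refl : ∀ x, d x x = 0
  symm : ∀ x y, d x y = d y x
  triangle : ∀ x y z, d x z ≤ d x y + d y z

/-- Matchings (couplings) of two distributions. -/
def Matching {X : Type u} (π π' : PMF X) : Type u :=
  {ω : PMF (X × X) // ω.map Prod.fst = π ∧ ω.map Prod.snd = π'}

/-- The Kantorovich lifting of `d`. -/
noncomputable def kantorovich {X : Type u} (d : X → X → ℝ) (π π' : PMF X) : ℝ :=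
  ⨅ ω : Matching π π', ∑' z : X × X, d z.1 z.2 * (ω.1 z).toReal

/-- `d` is a `lam`-bisimulation metric for the transition relation `T`. -/
def IsBisimulationMetric {X : Type u} {A : Type v} (T : X → A → PMF X → Prop) (lam : ℝ)
    (d : X → X → ℝ) : Prop :=
  IsOneBoundedPseudometric d ∧
    ∀ t t', d t t' < 1 → ∀ a π, T t a π → ∃ π', T t' a π' ∧ lam * kantorovich d π π' ≤ d t t'

/-- `d` is the `lam`-bisimilarity metric, i.e. the smallest `lam`-bisimulation metric with respect
to the pointwise order. -/
def IsBisimilarityMetric {X : Type u} {A : Type v} (T : X → A → PMF X → Prop) (lam : ℝ)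
    (d : X → X → ℝ) : Prop :=
  IsLeast {d' : X → X → ℝ | IsBisimulationMetric T lam d'} d

/-- The operator `f` is `K`-Lipschitz continuous with respect to `d`. -/
def IsLipschitzOperator {S : Signature.{u}} (d : CTerm S → CTerm S → ℝ) {n : ℕ} (f : S.Op n)
    (K : ℝ) : Prop :=
  0 ≤ K ∧ ∀ s t : Fin n → CTerm S, d (.app f s) (.app f t) ≤ K * ∑ i, d (s i) (t i)

/-! ## The process algebra -/

/-- Parameters `p ∈ (0,1)` of probabilistic operators. -/
abbrev Prob : Type := Set.Ioo (0 : ℝ) 1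

/-- The operators of the process algebra with recursive operators, over the actions `A`. -/
inductive PAOp (A : Type u) : ℕ → Type u
  /-- the stopped process `0` -/
  | nil : PAOp A 0
  /-- skip `ε` -/
  | skip : PAOp A 0
  /-- probabilistic action prefixing `a.([p₁]_ ⊕ … ⊕ [pₙ]_)` -/
  | act {n : ℕ} (a : A) (p : PMF (Fin n)) (hp : ∀ i, p i ≠ 0) : PAOp A n
  /-- sequential composition `_ ; _` -/
  | seq : PAOp A 2
  /-- alternative composition `_ + _` -/
  | alt : PAOp A 2
  /-- probabilistic alternative composition `_ +_p _` -/
  | palt (p : Prob) : PAOp A 2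
  /-- synchronous parallel composition `_ | _` -/
  | sync : PAOp A 2
  /-- asynchronous parallel composition `_ ||| _` -/
  | par : PAOp A 2
  /-- probabilistic parallel composition `_ |||_p _` -/
  | ppar (p : Prob) : PAOp A 2
  /-- CSP-like parallel composition `_ ‖_B _` -/
  | csp (B : Set A) : PAOp A 2
  /-- finite iteration `_ ^ n` -/
  | iter (n : ℕ) : PAOp A 1
  /-- infinite iteration `_ ^ ω` -/
  | iterω : PAOp A 1
  /-- binary Kleene star `_ * _` -/
  | star : PAOp A 2
  /-- probabilistic Kleene star `_ *_p _` -/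
  | pstar (p : Prob) : PAOp A 2
  /-- finite replication `!^n _` -/
  | repl (n : ℕ) : PAOp A 1
  /-- infinite replication `! _` -/
  | bang : PAOp A 1
  /-- probabilistic replication `!_p _` -/
  | pbang (p : Prob) : PAOp A 1

/-- The signature of the process algebra. -/
def paSig (A : Type u) : Signature.{u} := ⟨PAOp A⟩

/-- Weight `p` on `true`, weight `1 - p` on `false`. -/
noncomputable def Prob.pmf (p : Prob) : PMF Bool :=
  PMF.ofFintype (fun b => ENNReal.ofReal (if b then p.1 else 1 - p.1)) (by
    have h := p.2
    simp only [Fintype.sum_bool, if_true, Bool.false_eq_true, if_false]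
    rw [← ENNReal.ofReal_add h.1.le (sub_nonneg.2 h.2.le)]
    simp)

theorem Prob.pmf_ne_zero (p : Prob) (b : Bool) : p.pmf b ≠ 0 := by
  have h := p.2
  cases b <;> simp [Prob.pmf, PMF.ofFintype_apply, h.1, h.2]

section Rules

variable {A : Type u}

/-- `θ₁ ⊕_p θ₂`. -/
noncomputable def DTerm.mix {S : Signature.{u}} {Vs Vd : Type} (p : Prob) (θ₁ θ₂ : DTerm S Vs Vd) :
    DTerm S Vs Vd :=
  .conv p.pmf p.pmf_ne_zero fun b => if b then θ₁ else θ₂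

/-- The operator `f` applied to two distribution terms. -/
def paBin {Vs Vd : Type} (f : PAOp A 2) (θ₁ θ₂ : DTerm (paSig A) Vs Vd) : DTerm (paSig A) Vs Vd :=
  .app (S := paSig A) f ![θ₁, θ₂]

/-- `δ(x)` for a state variable `x`. -/
def paDirac {Vs Vd : Type} (x : Vs) : DTerm (paSig A) Vs Vd := .dirac (.var x)

/-- `δ(f(x))` for a unary operator `f` and a state variable `x`. -/
def paDirac₁ {Vs Vd : Type} (f : PAOp A 1) (x : Vs) : DTerm (paSig A) Vs Vd :=
  .dirac (.app (S := paSig A) f ![.var x])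

/-- `δ(f(x, y))` for a binary operator `f` and state variables `x`, `y`. -/
def paDirac₂ {Vs Vd : Type} (f : PAOp A 2) (x y : Vs) : DTerm (paSig A) Vs Vd :=
  .dirac (.app (S := paSig A) f ![.var x, .var y])

/-- `δ(0)`. -/
def paStop {Vs Vd : Type} : DTerm (paSig A) Vs Vd := .dirac (.app (S := paSig A) .nil ![])

/-- A rule without premises. -/
def rule₀ {n : ℕ} (θ : DTerm (paSig A) (Fin n) (Fin 0)) : Rule (paSig A) A n :=
  ⟨0, ![], ![], ∅, θ⟩

/-- A rule with the single premise `xᵢ —a→ μ₀`. -/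
def rule₁ {n : ℕ} (i : Fin n) (a : A) (θ : DTerm (paSig A) (Fin n) (Fin 1)) :
    Rule (paSig A) A n :=
  ⟨1, ![i], ![a], ∅, θ⟩

/-- A rule with the premises `xᵢ —a→ μ₀` and `xⱼ —b→ μ₁`. -/
def rule₂ {n : ℕ} (i : Fin n) (a : A) (j : Fin n) (b : A)
    (θ : DTerm (paSig A) (Fin n) (Fin 2)) : Rule (paSig A) A n :=
  ⟨2, ![i, j], ![a, b], ∅, θ⟩

/-- A rule with the premises `xᵢ —a→ μ₀` and `xⱼ —b↛`. -/
def ruleNeg {n : ℕ} (i : Fin n) (a : A) (j : Fin n) (b : A)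
    (θ : DTerm (paSig A) (Fin n) (Fin 1)) : Rule (paSig A) A n :=
  ⟨1, ![i], ![a], {(j, b)}, θ⟩

/-- The rule `r` under a side condition `c`. -/
def provided {R : Type*} (c : Prop) (r : R) : Set R := {r' | c ∧ r' = r}

/-- The rules of the process algebra with conclusion label `a`; `tick` is the successful
termination action. The source variables are `0` (and `1`), the distribution variables
`.var 0`, `.var 1` belong to the positive premises in their order. -/
noncomputable def paRules (tick : A) : {n : ℕ} → PAOp A n → A → Set (Rule (paSig A) A n)
  | _, .nil, _ => ∅
  | _, .skip, a => provided (a = tick) (rule₀ paStop)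
  | _, .act b p hp, a => provided (a = b) (rule₀ (.conv p hp fun i => paDirac i))
  | _, .seq, a =>
      provided (a ≠ tick) (rule₁ 0 a (paBin .seq (.var 0) (paDirac 1))) ∪
      {rule₂ 0 tick 1 a (.var 1)}
  | _, .alt, a => {rule₁ 0 a (.var 0), rule₁ 1 a (.var 0)}
  | _, .palt p, a =>
      {ruleNeg 0 a 1 a (.var 0), ruleNeg 1 a 0 a (.var 0),
        rule₂ 0 a 1 a (.mix p (.var 0) (.var 1))}
  | _, .sync, a =>
      provided (a ≠ tick) (rule₂ 0 a 1 a (paBin .sync (.var 0) (.var 1))) ∪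
      provided (a = tick) (rule₂ 0 tick 1 tick paStop)
  | _, .par, a =>
      provided (a ≠ tick) (rule₁ 0 a (paBin .par (.var 0) (paDirac 1))) ∪
      provided (a ≠ tick) (rule₁ 1 a (paBin .par (paDirac 0) (.var 0))) ∪
      provided (a = tick) (rule₂ 0 tick 1 tick paStop)
  | _, .ppar p, a =>
      provided (a ≠ tick) (ruleNeg 0 a 1 a (paBin (.ppar p) (.var 0) (paDirac 1))) ∪
      provided (a ≠ tick) (ruleNeg 1 a 0 a (paBin (.ppar p) (paDirac 0) (.var 0))) ∪
      provided (a ≠ tick) (rule₂ 0 a 1 a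
        (.mix p (paBin (.ppar p) (.var 0) (paDirac 1)) (paBin (.ppar p) (paDirac 0) (.var 1)))) ∪
      provided (a = tick) (rule₂ 0 tick 1 tick paStop)
  | _, .csp B, a =>
      provided (a ∈ B \ {tick}) (rule₂ 0 a 1 a (paBin (.csp B) (.var 0) (.var 1))) ∪
      provided (a = tick) (rule₂ 0 tick 1 tick paStop) ∪
      provided (a ∉ B ∪ {tick}) (rule₁ 0 a (paBin (.csp B) (.var 0) (paDirac 1))) ∪
      provided (a ∉ B ∪ {tick}) (rule₁ 1 a (paBin (.csp B) (paDirac 0) (.var 0)))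
  | _, .iter 0, a => provided (a = tick) (rule₀ paStop)
  | _, .iter (n + 1), a =>
      provided (a ≠ tick) (rule₁ 0 a (paBin .seq (.var 0) (paDirac₁ (.iter n) 0))) ∪
      provided (a = tick) (rule₁ 0 tick (.var 0)) ∪
      ⋃ m ∈ Finset.range (n + 1),
        provided (a ≠ tick) (rule₂ 0 tick 0 a (paBin .seq (.var 1) (paDirac₁ (.iter m) 0)))
  | _, .iterω, a => provided (a ≠ tick) (rule₁ 0 a (paBin .seq (.var 0) (paDirac₁ .iterω 0)))
  | _, .star, a =>
      provided (a ≠ tick) (rule₁ 0 a (paBin .seq (.var 0) (paDirac₂ .star 0 1))) ∪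
      {rule₁ 1 a (.var 0)}
  | _, .pstar p, a =>
      provided (a ≠ tick) (rule₂ 0 a 1 a
        (.mix p (.var 1) (paBin .seq (.var 0) (paDirac₂ (.pstar p) 0 1)))) ∪
      provided (a ≠ tick) (ruleNeg 0 a 1 a (paBin .seq (.var 0) (paDirac₂ (.pstar p) 0 1))) ∪
      provided (a ≠ tick) (ruleNeg 1 a 0 a (.var 0)) ∪
      provided (a = tick) (rule₁ 1 tick (.var 0))
  | _, .repl 0, a => provided (a = tick) (rule₀ paStop)
  | _, .repl (n + 1), a =>
      provided (a ≠ tick) (rule₁ 0 a (paBin .par (.var 0) (paDirac₁ (.repl n) 0))) ∪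
      provided (a = tick) (rule₁ 0 tick (.var 0))
  | _, .bang, a => provided (a ≠ tick) (rule₁ 0 a (paBin .par (.var 0) (paDirac₁ .bang 0)))
  | _, .pbang p, a =>
      provided (a ≠ tick) (rule₁ 0 a
        (.mix p (.var 0) (paBin .par (.var 0) (paDirac₁ (.pbang p) 0))))

theorem provided_finite {R : Type*} (c : Prop) (r : R) : (provided c r).Finite :=
  (Set.finite_singleton r).subset fun _ h => h.2

theorem paRules_finite (tick : A) {n : ℕ} (f : PAOp A n) (a : A) : (paRules tick f a).Finite := by
  cases f with
  | iter n =>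
    cases n with
    | zero => simp [paRules, provided_finite]
    | succ n =>
      simp only [paRules, Set.finite_union, provided_finite, true_and]
      exact (Finset.finite_toSet _).biUnion fun _ _ => provided_finite _ _
  | repl n => cases n <;> simp [paRules, provided_finite]
  | _ => simp [paRules, provided_finite]

/-- The specification of the process algebra with recursive operators. -/
noncomputable def paSpec (tick : A) : PTSS (paSig A) A where
  rules f a := paRules tick f a
  finite_rules f a := paRules_finite tick f a

end Rules

/-! Existence. A pointwise infimum of bisimulation metrics can violate the triangle inequality, so
it is replaced by the largest pseudometric below it. One step of the bisimulation game, `bisimStep`,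
preserves pseudometrics and is monotone, because the Kantorovich lifting is. Hence a step that stays
below a function also stays below the largest pseudometric under it. Finitely many rules per
operator and label make the model image-finite, so infima over matching transitions are attained and
a pseudometric `d` with `bisimStep d ≤ d` is a bisimulation metric. The same construction gives a
coinduction principle (`IsBisimilarityMetric.le_of_coinduction`) for proving upper bounds on the
least metric.

Continuity. By coinduction, `;` and `|||` are non-expansive: the distance of composites is at most
the sum of the distances of the components (`dist_seq_le`, `dist_par_le`). A step moves one
component, and the cost of the idle one is only multiplied by `lam ≤ 1`. Unfolding an iteration or
replication once then costs `d x y` for the moving copy plus the bound for the remaining copies, so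
induction yields the factor `n`. For the bang, the spawned copy appears only with probability `1 -
p` and one step later, so the distance `D` of `!_p x` and `!_p y` satisfies `D ≤ d x y + (1 - p) *
lam * D`. Since `D` is finite and `(1 - p) * lam < 1`, this can be solved for `D`. -/

theorem PMF.map_fun_const {X Y : Type*} (p : PMF X) (y : Y) : p.map (fun _ => y) = PMF.pure y :=
  p.map_const y

theorem PMF.map_fun_id {X : Type*} (p : PMF X) : p.map (fun x => x) = p := p.map_id

/-! ## Expectations under discrete distributions -/

theorem PMF.summable_toReal {X : Type*} (p : PMF X) : Summable fun x => (p x).toReal :=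
  ENNReal.summable_toReal p.tsum_coe_ne_top

theorem PMF.tsum_toReal {X : Type*} (p : PMF X) : ∑' x, (p x).toReal = 1 := by
  rw [← ENNReal.tsum_toReal_eq fun x => p.apply_ne_top x, p.tsum_coe, ENNReal.toReal_one]

/-- The expectation of `g` under `p`. -/
noncomputable def expect {X : Type*} (p : PMF X) (g : X → ℝ) : ℝ := ∑' x, g x * (p x).toReal

theorem summable_expect {X : Type*} (p : PMF X) {g : X → ℝ} {C : ℝ} (h0 : ∀ x, 0 ≤ g x)
    (h1 : ∀ x, g x ≤ C) : Summable fun x => g x * (p x).toReal :=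
  Summable.of_nonneg_of_le (fun x => mul_nonneg (h0 x) ENNReal.toReal_nonneg)
    (fun x => mul_le_mul_of_nonneg_right (h1 x) ENNReal.toReal_nonneg)
    (p.summable_toReal.mul_left C)

theorem expect_nonneg {X : Type*} (p : PMF X) {g : X → ℝ} (h0 : ∀ x, 0 ≤ g x) : 0 ≤ expect p g :=
  tsum_nonneg fun x => mul_nonneg (h0 x) ENNReal.toReal_nonneg

theorem expect_const {X : Type*} (p : PMF X) (c : ℝ) : expect p (fun _ => c) = c := by
  rw [expect, tsum_mul_left, p.tsum_toReal, mul_one]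

theorem expect_mono {X : Type*} (p : PMF X) {g h : X → ℝ} {C : ℝ} (g0 : ∀ x, 0 ≤ g x)
    (hC : ∀ x, h x ≤ C) (hgh : ∀ x, g x ≤ h x) : expect p g ≤ expect p h :=
  (summable_expect p g0 fun x => (hgh x).trans (hC x)).tsum_le_tsum
    (fun x => mul_le_mul_of_nonneg_right (hgh x) ENNReal.toReal_nonneg)
    (summable_expect p (fun x => (g0 x).trans (hgh x)) hC)

theorem expect_add {X : Type*} (p : PMF X) {g h : X → ℝ} {C D : ℝ} (g0 : ∀ x, 0 ≤ g x)
    (gC : ∀ x, g x ≤ C) (h0 : ∀ x, 0 ≤ h x) (hD : ∀ x, h x ≤ D) :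
    expect p (fun x => g x + h x) = expect p g + expect p h := by
  simp only [expect, add_mul]
  exact (summable_expect p g0 gC).tsum_add (summable_expect p h0 hD)

/-- Moves expectations to `ENNReal`, where sums may be interchanged without summability conditions.
-/
theorem expect_eq_toReal {X : Type*} (p : PMF X) {g : X → ℝ} (g0 : ∀ x, 0 ≤ g x) :
    expect p g = (∑' x, ENNReal.ofReal (g x) * p x).toReal := by
  rw [ENNReal.tsum_toReal_eq fun x => ENNReal.mul_ne_top ENNReal.ofReal_ne_top (p.apply_ne_top x)]
  exact tsum_congr fun x => by rw [ENNReal.toReal_mul, ENNReal.toReal_ofReal (g0 x)]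

theorem tsum_mul_bind {X Y : Type*} (p : PMF X) (k : X → PMF Y) (g : Y → ENNReal) :
    ∑' y, g y * p.bind k y = ∑' x, p x * ∑' y, g y * k x y := by
  simp only [PMF.bind_apply, ← ENNReal.tsum_mul_left]
  rw [ENNReal.tsum_comm]
  exact tsum_congr fun x => tsum_congr fun y => by ring

theorem expect_map {X Y : Type*} (p : PMF X) (f : X → Y) {g : Y → ℝ} (g0 : ∀ y, 0 ≤ g y) :
    expect (p.map f) g = expect p fun x => g (f x) := by
  classical
  rw [expect_eq_toReal _ g0, expect_eq_toReal _ fun x => g0 (f x), ← PMF.bind_pure_comp,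
    tsum_mul_bind]
  congr 1
  refine tsum_congr fun x => ?_
  rw [tsum_eq_single (f x) fun y hy => by simp [PMF.pure_apply, hy], mul_comm]
  simp

theorem expect_bind_fintype {X Y : Type*} [Fintype X] (p : PMF X) (k : X → PMF Y) {g : Y → ℝ}
    {C : ℝ} (g0 : ∀ y, 0 ≤ g y) (gC : ∀ y, g y ≤ C) :
    expect (p.bind k) g = ∑ x, (p x).toReal * expect (k x) g := by
  rw [expect_eq_toReal _ g0, tsum_mul_bind, tsum_fintype, ENNReal.toReal_sum]
  · exact Finset.sum_congr rfl fun x _ => by rw [ENNReal.toReal_mul, expect_eq_toReal _ g0]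
  · intro x _
    -- The bound `C` keeps each inner expectation finite, so that `toReal` commutes with the finite
    -- sum.
    refine ENNReal.mul_ne_top (p.apply_ne_top x)
      (ne_top_of_le_ne_top (b := ENNReal.ofReal C) ENNReal.ofReal_ne_top ?_)
    calc ∑' y, ENNReal.ofReal (g y) * k x y ≤ ∑' y, ENNReal.ofReal C * k x y :=
          ENNReal.tsum_le_tsum fun y => by gcongr; exact gC y
      _ = ENNReal.ofReal C := by rw [ENNReal.tsum_mul_left, (k x).tsum_coe, mul_one]

/-! ## Couplings -/

theorem PMF.map_fst_apply {X Y : Type*} (ω : PMF (X × Y)) (x : X) :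
    ω.map Prod.fst x = ∑' y, ω (x, y) := by
  classical
  rw [PMF.map_apply, ENNReal.tsum_prod', tsum_eq_single x]
  · simp
  · intro x' hx'
    simp [hx'.symm]

/-- A distribution on pairs is given by its first marginal and conditional distributions. -/
theorem PMF.exists_disintegration {X Y : Type*} (ω : PMF (X × Y)) :
    ∃ k : X → PMF Y, ((ω.map Prod.fst).bind fun x => (k x).map (Prod.mk x)) = ω := by
  classical
  -- The point mass at `y₀` serves as conditional law at points of zero marginal mass, where the
  -- choice is immaterial.
  obtain ⟨y₀⟩ : Nonempty Y := ω.support_nonempty.to_subtype.map fun z => z.1.2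
  have htop (x : X) : ∑' y, ω (x, y) ≠ ⊤ := by
    rw [← map_fst_apply]
    exact PMF.apply_ne_top _ _
  have hk (x : X) : ∃ q : PMF Y, ∀ y, (∑' y, ω (x, y)) * q y = ω (x, y) := by
    by_cases h : ∑' y, ω (x, y) = 0
    · exact ⟨PMF.pure y₀, fun y => by rw [h, zero_mul, ENNReal.tsum_eq_zero.1 h y]⟩
    · refine ⟨PMF.normalize (fun y => ω (x, y)) h (htop x), fun y => ?_⟩
      rw [PMF.normalize_apply, mul_comm, mul_assoc, ENNReal.inv_mul_cancel h (htop x), mul_one]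
  choose k hk using hk
  refine ⟨k, ?_⟩
  ext ⟨x, y⟩
  rw [PMF.bind_apply, tsum_eq_single x]
  · have hy : (k x).map (Prod.mk x) (x, y) = k x y := by
      rw [PMF.map_apply, tsum_eq_single y fun y' hy' => by simp [hy'.symm]]
      simp
    rw [map_fst_apply, hy, hk]
  · intro x' hx'
    simp [PMF.map_apply (Prod.mk x'), hx'.symm]

/-- Draw a pair from `ω₁`, then draw the third coordinate from the conditional law of `ω₂` given the
middle one. This is what the triangle inequality for the Kantorovich lifting rests on. -/
theorem PMF.exists_gluing {X Y Z : Type*} (ω₁ : PMF (X × Y)) (ω₂ : PMF (Y × Z))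
    (h : ω₁.map Prod.snd = ω₂.map Prod.fst) :
    ∃ γ : PMF (X × Y × Z), γ.map (fun z => (z.1, z.2.1)) = ω₁ ∧ γ.map Prod.snd = ω₂ := by
  obtain ⟨k, hk⟩ := ω₂.exists_disintegration
  refine ⟨ω₁.bind fun z => (k z.2).map fun w => (z.1, z.2, w), ?_, ?_⟩
  · simp only [PMF.map_bind, PMF.map_comp, Function.comp_def, PMF.map_fun_const]
    exact ω₁.bind_pure
  · rw [← hk, ← h, PMF.bind_map]
    simp only [PMF.map_bind, PMF.map_comp, Function.comp_def]

/-- Functions with values in the unit interval. -/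
def UnitValued {X : Type u} (d : X → X → ℝ) : Prop := ∀ x y, 0 ≤ d x y ∧ d x y ≤ 1

theorem IsOneBoundedPseudometric.unitValued {X : Type u} {d : X → X → ℝ}
    (hd : IsOneBoundedPseudometric d) : UnitValued d :=
  fun x y => ⟨hd.nonneg x y, hd.le_one x y⟩

/-- The independent coupling. Without it the infimum in `kantorovich` could be the junk value of an
empty family. -/
instance {X : Type u} (π π' : PMF X) : Nonempty (Matching π π') :=
  ⟨⟨π.bind fun x => π'.map (Prod.mk x), by
    simp [PMF.map_bind, PMF.map_comp, Function.comp_def, PMF.map_fun_const], by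
    simp [PMF.map_bind, PMF.map_comp, Function.comp_def, PMF.map_fun_id]⟩⟩

/-! ### The Kantorovich lifting. -/

section Kantorovich

variable {X : Type u} {d e : X → X → ℝ}

theorem kantorovich_le (hd : UnitValued d) {π π' : PMF X} (ω : PMF (X × X))
    (h : ω.map Prod.fst = π) (h' : ω.map Prod.snd = π') :
    kantorovich d π π' ≤ expect ω fun z => d z.1 z.2 :=
  ciInf_le ⟨0, by
    rintro _ ⟨ω, rfl⟩
    exact expect_nonneg ω.1 fun z => (hd z.1 z.2).1⟩ (⟨ω, h, h'⟩ : Matching π π')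

theorem le_kantorovich {π π' : PMF X} {c : ℝ}
    (h : ∀ ω : PMF (X × X), ω.map Prod.fst = π → ω.map Prod.snd = π' →
      c ≤ expect ω fun z => d z.1 z.2) : c ≤ kantorovich d π π' :=
  le_ciInf fun ω => h ω.1 ω.2.1 ω.2.2

theorem kantorovich_nonneg (hd : UnitValued d) (π π' : PMF X) : 0 ≤ kantorovich d π π' :=
  le_kantorovich fun ω _ _ => expect_nonneg ω fun z => (hd z.1 z.2).1

/-- Pushing forward along maps that increase the distance by at most `c`. -/
theorem kantorovich_map_le (hd : UnitValued d) (he : UnitValued e) {c : ℝ} (hc : 0 ≤ c)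
    (f g : X → X) (h : ∀ x y, e (f x) (g y) ≤ d x y + c) (π π' : PMF X) :
    kantorovich e (π.map f) (π'.map g) ≤ kantorovich d π π' + c := by
  rw [← sub_le_iff_le_add]
  refine le_kantorovich fun ω h₁ h₂ => ?_
  rw [sub_le_iff_le_add]
  refine (kantorovich_le he (ω.map (Prod.map f g)) ?_ ?_).trans ?_
  · rw [← h₁, PMF.map_comp, PMF.map_comp]
    rfl
  · rw [← h₂, PMF.map_comp, PMF.map_comp]
    rfl
  · rw [expect_map _ _ fun z : X × X => (he z.1 z.2).1]
    refine (expect_mono ω (C := 1 + c) (fun z => (he _ _).1)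
      (fun z => add_le_add_left (hd z.1 z.2).2 c) fun z => h z.1 z.2).trans_eq ?_
    rw [expect_add ω (C := 1) (fun z => (hd z.1 z.2).1) (fun z => (hd z.1 z.2).2) (fun _ => hc)
      fun _ => le_rfl, expect_const]

theorem kantorovich_mono (hd : UnitValued d) (he : UnitValued e) (h : ∀ x y, e x y ≤ d x y)
    (π π' : PMF X) : kantorovich e π π' ≤ kantorovich d π π' := by
  simpa [PMF.map_id] using
    kantorovich_map_le hd he le_rfl id id (fun x y => by simpa using h x y) π π'

theorem kantorovich_self (hd : IsOneBoundedPseudometric d) (π : PMF X) :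
    kantorovich d π π = 0 := by
  refine le_antisymm ?_ (kantorovich_nonneg hd.unitValued π π)
  refine (kantorovich_le hd.unitValued (π.map fun x => (x, x)) ?_ ?_).trans_eq ?_
  · simp [PMF.map_comp, Function.comp_def, PMF.map_fun_id]
  · simp [PMF.map_comp, Function.comp_def, PMF.map_fun_id]
  · rw [expect_map _ _ fun z => hd.nonneg _ _]
    simp [hd.refl, expect_const]

theorem kantorovich_triangle (hd : IsOneBoundedPseudometric d) (π₁ π₂ π₃ : PMF X) :
    kantorovich d π₁ π₃ ≤ kantorovich d π₁ π₂ + kantorovich d π₂ π₃ := by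
  rw [← sub_le_iff_le_add]
  refine le_kantorovich fun ω₁ h₁ h₂ => ?_
  rw [sub_le_iff_le_add, ← sub_le_iff_le_add']
  refine le_kantorovich fun ω₂ h₃ h₄ => ?_
  rw [sub_le_iff_le_add']
  -- Forgetting the middle coordinate of the glued distribution couples the outer two.
  obtain ⟨γ, rfl, rfl⟩ := ω₁.exists_gluing ω₂ (h₂.trans h₃.symm)
  refine (kantorovich_le hd.unitValued (γ.map fun z => (z.1, z.2.2)) ?_ ?_).trans ?_
  · rw [← h₁, PMF.map_comp, PMF.map_comp]
    rfl
  · rw [← h₄, PMF.map_comp, PMF.map_comp]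
    rfl
  · rw [expect_map _ _ fun z => hd.nonneg _ _, expect_map _ _ fun z => hd.nonneg _ _,
      expect_map _ _ fun z => hd.nonneg _ _,
      ← expect_add γ (C := 1) (D := 1) (fun z => hd.nonneg _ _) (fun z => hd.le_one _ _)
        (fun z => hd.nonneg _ _) fun z => hd.le_one _ _]
    exact expect_mono γ (C := 1 + 1) (fun z => hd.nonneg _ _)
      (fun z => add_le_add (hd.le_one _ _) (hd.le_one _ _)) fun z => hd.triangle _ _ _

/-- The Kantorovich lifting is convex. -/
theorem kantorovich_mix_le (hd : UnitValued d) (p : Prob) (k k' : Bool → PMF X) :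
    kantorovich d (p.pmf.bind k) (p.pmf.bind k') ≤
      p.1 * kantorovich d (k true) (k' true) + (1 - p.1) * kantorovich d (k false) (k' false) := by
  have hp : 0 < p.1 := p.2.1
  have hq : 0 < 1 - p.1 := sub_pos.2 p.2.2
  -- Isolating each lifting on the right lets it be replaced by an arbitrary coupling; the
  -- `p`-mixture of the two couplings then couples the mixtures.
  rw [← sub_le_iff_le_add, ← div_le_iff₀' hp]
  refine le_kantorovich fun ω₁ h₁ h₁' => ?_
  rw [div_le_iff₀' hp, sub_le_iff_le_add, ← sub_le_iff_le_add', ← div_le_iff₀' hq]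
  refine le_kantorovich fun ω₀ h₀ h₀' => ?_
  rw [div_le_iff₀' hq, sub_le_iff_le_add']
  refine (kantorovich_le hd (p.pmf.bind fun b => if b then ω₁ else ω₀) ?_ ?_).trans_eq ?_
  · rw [PMF.map_bind]
    congr 1
    funext b
    cases b <;> simp [h₁, h₀]
  · rw [PMF.map_bind]
    congr 1
    funext b
    cases b <;> simp [h₁', h₀']
  · rw [expect_bind_fintype _ _ (C := 1) (fun z => (hd _ _).1) fun z => (hd _ _).2]
    simp [Prob.pmf, PMF.ofFintype_apply, hp.le, hq.le]

end Kantorovich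

/-! ## The bisimilarity metric -/

section Bisimilarity

variable {X : Type u} {A : Type v} (T : X → A → PMF X → Prop) (lam : ℝ)

/-- Each transition of `t` is matched by a transition of `t'` up to the discounted distance `r`. -/
def SimulatesUpTo (d : X → X → ℝ) (t t' : X) (r : ℝ) : Prop :=
  ∀ a π, T t a π → ∃ π', T t' a π' ∧ lam * kantorovich d π π' ≤ r

/-- The values admitted by one step of the bisimulation game. -/
def stepValues (d : X → X → ℝ) (t t' : X) : Set ℝ :=
  {r | 0 ≤ r ∧ (1 ≤ r ∨ SimulatesUpTo T lam d t t' r ∧ SimulatesUpTo T lam d t' t r)}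

/-- One step of the bisimulation game. -/
noncomputable def bisimStep (d : X → X → ℝ) (t t' : X) : ℝ := sInf (stepValues T lam d t t')

/-- The largest one-bounded pseudometric below `e`. -/
noncomputable def pseudometricBelow (e : X → X → ℝ) (x y : X) : ℝ :=
  ⨆ d : {d : X → X → ℝ // IsOneBoundedPseudometric d ∧ ∀ x y, d x y ≤ e x y}, d.1 x y

variable {T lam} {d e : X → X → ℝ}

theorem IsOneBoundedPseudometric.zero : IsOneBoundedPseudometric fun _ _ : X => (0 : ℝ) := by
  constructor <;> simp

theorem le_pseudometricBelow (hd : IsOneBoundedPseudometric d) (h : ∀ x y, d x y ≤ e x y)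
    (x y : X) : d x y ≤ pseudometricBelow e x y :=
  le_ciSup (f := fun d : {d : X → X → ℝ // IsOneBoundedPseudometric d ∧ ∀ x y, d x y ≤ e x y} =>
    d.1 x y) ⟨1, by rintro _ ⟨d, rfl⟩; exact d.2.1.le_one x y⟩ ⟨d, hd, h⟩

theorem pseudometricBelow_le_of_forall (he : ∀ x y, 0 ≤ e x y) {x y : X} {c : ℝ}
    (h : ∀ d : X → X → ℝ, IsOneBoundedPseudometric d → (∀ x y, d x y ≤ e x y) → d x y ≤ c) :
    pseudometricBelow e x y ≤ c :=
  have : Nonempty {d : X → X → ℝ // IsOneBoundedPseudometric d ∧ ∀ x y, d x y ≤ e x y} :=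
    ⟨⟨_, .zero, he⟩⟩
  ciSup_le fun d => h d.1 d.2.1 d.2.2

theorem pseudometricBelow_le (he : ∀ x y, 0 ≤ e x y) (x y : X) : pseudometricBelow e x y ≤ e x y :=
  pseudometricBelow_le_of_forall he fun _ _ h => h x y

theorem isOneBoundedPseudometric_pseudometricBelow (he : ∀ x y, 0 ≤ e x y) :
    IsOneBoundedPseudometric (pseudometricBelow e) where
  nonneg x y := le_pseudometricBelow .zero he x y
  le_one x y := pseudometricBelow_le_of_forall he fun d hd _ => hd.le_one x y
  refl x := le_antisymm (pseudometricBelow_le_of_forall he fun d hd _ => (hd.refl x).le)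
    (le_pseudometricBelow .zero he x x)
  symm x y := by
    refine le_antisymm ?_ ?_ <;>
    exact pseudometricBelow_le_of_forall he fun d hd h =>
      hd.symm _ _ ▸ le_pseudometricBelow hd h _ _
  triangle x y z := pseudometricBelow_le_of_forall he fun d hd h =>
    (hd.triangle x y z).trans
      (add_le_add (le_pseudometricBelow hd h x y) (le_pseudometricBelow hd h y z))

theorem bddBelow_stepValues (t t' : X) : BddBelow (stepValues T lam d t t') := ⟨0, fun _ h => h.1⟩

theorem one_mem_stepValues (t t' : X) : 1 ∈ stepValues T lam d t t' :=
  ⟨zero_le_one, .inl le_rfl⟩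

theorem bisimStep_nonneg (t t' : X) : 0 ≤ bisimStep T lam d t t' :=
  le_csInf ⟨1, one_mem_stepValues t t'⟩ fun _ h => h.1

theorem bisimStep_le {t t' : X} {r : ℝ} (h : r ∈ stepValues T lam d t t') :
    bisimStep T lam d t t' ≤ r :=
  csInf_le (bddBelow_stepValues t t') h

theorem SimulatesUpTo.mono (hlam : 0 < lam) (hd : UnitValued d) (he : UnitValued e)
    (hed : ∀ x y, e x y ≤ d x y) {t t' : X} {r s : ℝ} (hrs : r ≤ s)
    (h : SimulatesUpTo T lam d t t' r) : SimulatesUpTo T lam e t t' s := by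
  intro a π hπ
  obtain ⟨π', hπ', hle⟩ := h a π hπ
  exact ⟨π', hπ', (mul_le_mul_of_nonneg_left (kantorovich_mono hd he hed π π') hlam.le).trans
    (hle.trans hrs)⟩

theorem SimulatesUpTo.trans (hlam : 0 < lam) (hd : IsOneBoundedPseudometric d) {t₁ t₂ t₃ : X}
    {r s : ℝ} (h : SimulatesUpTo T lam d t₁ t₂ r) (h' : SimulatesUpTo T lam d t₂ t₃ s) :
    SimulatesUpTo T lam d t₁ t₃ (r + s) := by
  intro a π hπ
  obtain ⟨π', hπ', hle⟩ := h a π hπ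
  obtain ⟨π'', hπ'', hle'⟩ := h' a π' hπ'
  refine ⟨π'', hπ'', ?_⟩
  calc lam * kantorovich d π π'' ≤ lam * (kantorovich d π π' + kantorovich d π' π'') :=
        mul_le_mul_of_nonneg_left (kantorovich_triangle hd _ _ _) hlam.le
    _ ≤ r + s := by rw [mul_add]; exact add_le_add hle hle'

/-- Admitted values add up along composed simulations, forwards and backwards, which gives the
triangle inequality; if either value is at least `1`, so is the sum. This is what allows a step to
be compared with `pseudometricBelow`. -/
theorem isOneBoundedPseudometric_bisimStep (hlam : 0 < lam) (hd : IsOneBoundedPseudometric d) :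
    IsOneBoundedPseudometric (bisimStep T lam d) where
  nonneg := bisimStep_nonneg
  le_one t t' := bisimStep_le (one_mem_stepValues t t')
  refl t := by
    refine le_antisymm (bisimStep_le ⟨le_rfl, .inr ?_⟩) (bisimStep_nonneg t t)
    have h : SimulatesUpTo T lam d t t 0 := fun a π hπ =>
      ⟨π, hπ, by rw [kantorovich_self hd, mul_zero]⟩
    exact ⟨h, h⟩
  symm t t' := by simp only [bisimStep, stepValues, and_comm]
  triangle t₁ t₂ t₃ := by
    rw [← sub_le_iff_le_add]
    refine le_csInf ⟨1, one_mem_stepValues _ _⟩ fun r hr => ?_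
    rw [sub_le_iff_le_add, ← sub_le_iff_le_add']
    refine le_csInf ⟨1, one_mem_stepValues _ _⟩ fun s hs => ?_
    rw [sub_le_iff_le_add']
    refine bisimStep_le ⟨add_nonneg hr.1 hs.1, ?_⟩
    rcases hr with ⟨hr0, hr | hr⟩
    · exact .inl (by linarith [hs.1])
    rcases hs with ⟨hs0, hs | hs⟩
    · exact .inl (by linarith)
    exact .inr ⟨hr.1.trans hlam hd hs.1, add_comm r s ▸ hs.2.trans hlam hd hr.2⟩

/-- In an image-finite system the infimum over the matching transitions is attained. -/
theorem simulatesUpTo_bisimStep (hT : ∀ t a, {π | T t a π}.Finite) {t t' : X}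
    (h : bisimStep T lam d t t' < 1) :
    SimulatesUpTo T lam d t t' (bisimStep T lam d t t') := by
  intro a π hπ
  have key : ∀ r, bisimStep T lam d t t' < r → ∃ π', T t' a π' ∧ lam * kantorovich d π π' ≤ r := by
    intro r hr
    -- Going below `min r 1` forces `s < 1`, which rules out the clause `1 ≤ s` and leaves actual
    -- simulations.
    obtain ⟨s, hs, hsr⟩ := exists_lt_of_csInf_lt ⟨1, one_mem_stepValues t t'⟩ (lt_min hr h)
    have hs1 := hs.2.resolve_left (not_le.2 (hsr.trans_le (min_le_right _ _)))
    obtain ⟨π', hπ', hle⟩ := hs1.1 a π hπ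
    exact ⟨π', hπ', hle.trans (hsr.le.trans (min_le_left _ _))⟩
  obtain ⟨π₁, hπ₁, -⟩ := key 1 h
  -- The cheapest of the finitely many candidates is as good as the match found for any `r`, so it
  -- serves all `r` at once.
  obtain ⟨π', hπ', hmin⟩ := (hT t' a).exists_minimalFor (fun π' => lam * kantorovich d π π') _
    ⟨π₁, hπ₁⟩
  refine ⟨π', hπ', le_of_forall_gt_imp_ge_of_dense fun r hr => ?_⟩
  obtain ⟨π'', hπ'', hle⟩ := key r hr
  rcases le_total (lam * kantorovich d π π') (lam * kantorovich d π π'') with h' | h'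
  · exact h'.trans hle
  · exact (hmin hπ'' h').trans hle

/-- Pre-fixed points of the step are bisimulation metrics; image-finiteness enters through the
attained infimum. -/
theorem isBisimulationMetric_of_bisimStep_le (hlam : 0 < lam) (hT : ∀ t a, {π | T t a π}.Finite)
    (hd : IsOneBoundedPseudometric d) (h : ∀ t t', bisimStep T lam d t t' ≤ d t t') :
    IsBisimulationMetric T lam d :=
  ⟨hd, fun t t' hlt => (simulatesUpTo_bisimStep hT ((h t t').trans_lt hlt)).mono
    hlam hd.unitValued hd.unitValued (fun _ _ => le_rfl) (h t t')⟩

theorem IsBisimulationMetric.simulatesUpTo (hd : IsBisimulationMetric T lam d) {t t' : X}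
    (h : d t t' < 1) : SimulatesUpTo T lam d t t' (d t t') :=
  hd.2 t t' h

theorem IsBisimulationMetric.mem_stepValues (hd : IsBisimulationMetric T lam d) (t t' : X) :
    d t t' ∈ stepValues T lam d t t' := by
  refine ⟨hd.1.nonneg t t', ?_⟩
  rcases le_or_gt 1 (d t t') with h | h
  · exact .inl h
  · have h' : d t' t < 1 := hd.1.symm t t' ▸ h
    exact .inr ⟨hd.simulatesUpTo h, hd.1.symm t' t ▸ hd.simulatesUpTo h'⟩

theorem stepValues_mono (hlam : 0 < lam) (hd : UnitValued d) (he : UnitValued e)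
    (hed : ∀ x y, e x y ≤ d x y) (t t' : X) :
    stepValues T lam d t t' ⊆ stepValues T lam e t t' := fun _ hr =>
  ⟨hr.1, hr.2.imp_right fun h => ⟨h.1.mono hlam hd he hed le_rfl, h.2.mono hlam hd he hed le_rfl⟩⟩

/-- The largest pseudometric below a function that is closed under the bisimulation game is a
bisimulation metric. -/
theorem isBisimulationMetric_pseudometricBelow (hlam : 0 < lam)
    (hT : ∀ t a, {π | T t a π}.Finite) (he : ∀ x y, 0 ≤ e x y)
    (h : ∀ t t', bisimStep T lam (pseudometricBelow e) t t' ≤ e t t') :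
    IsBisimulationMetric T lam (pseudometricBelow e) :=
  have hd := isOneBoundedPseudometric_pseudometricBelow he
  -- The step of a pseudometric is again a pseudometric; lying below `e`, it lies below the largest
  -- such one.
  isBisimulationMetric_of_bisimStep_le hlam hT hd
    (le_pseudometricBelow (isOneBoundedPseudometric_bisimStep hlam hd) h)

theorem isBisimulationMetric_discrete [DecidableEq X] :
    IsBisimulationMetric T lam fun x y => if x = y then 0 else 1 := by
  have hd : IsOneBoundedPseudometric fun x y : X => if x = y then (0 : ℝ) else 1 := by
    constructor
    · intro x y; positivity
    · intro x y; split_ifs <;> simp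
    · simp
    · simp [eq_comm]
    · intro x y z
      by_cases h : x = y
      · simp [h]
      · split_ifs <;> simp
  refine ⟨hd, fun t t' h a π hπ => ?_⟩
  have htt' : t = t' := by
    by_contra hne
    simp [hne] at h
  subst htt'
  exact ⟨π, hπ, by rw [kantorovich_self hd]; simp⟩

/-- `e` is the pointwise infimum of all bisimulation metrics, a family containing the discrete one.
By monotonicity a step from `pseudometricBelow e` stays below every member, hence below `e`. -/
theorem exists_isBisimilarityMetric (hlam : 0 < lam) (hT : ∀ t a, {π | T t a π}.Finite) :
    ∃ d, IsBisimilarityMetric T lam d := by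
  classical
  let M := {d : X → X → ℝ // IsBisimulationMetric T lam d}
  have : Nonempty M := ⟨⟨_, isBisimulationMetric_discrete⟩⟩
  let e : X → X → ℝ := fun x y => ⨅ d : M, d.1 x y
  have he : ∀ x y, 0 ≤ e x y := fun x y => le_ciInf fun d => d.2.1.nonneg x y
  have hed : ∀ (d : M) x y, e x y ≤ d.1 x y := fun d x y =>
    ciInf_le (f := fun d : M => d.1 x y) ⟨0, by rintro _ ⟨d, rfl⟩; exact d.2.1.nonneg x y⟩ d
  have hm := isOneBoundedPseudometric_pseudometricBelow he
  refine ⟨pseudometricBelow e, isBisimulationMetric_pseudometricBelow hlam hT he fun t t' => ?_,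
    fun d hd x y => (pseudometricBelow_le he x y).trans (hed ⟨d, hd⟩ x y)⟩
  exact le_ciInf fun d => bisimStep_le (stepValues_mono hlam d.2.1.unitValued hm.unitValued
    (fun x y => (pseudometricBelow_le he x y).trans (hed d x y)) t t' (d.2.mem_stepValues t t'))

/-- Coinduction up to the bisimilarity metric: a symmetric relation `R s t r`, read as an upper
bound `r` for the distance of `s` and `t`, is sound if each step leads back to a function below
`d` and `R`. -/
theorem IsBisimilarityMetric.le_of_coinduction (hlam : 0 < lam) (hT : ∀ t a, {π | T t a π}.Finite)
    (hd : IsBisimilarityMetric T lam d) (R : X → X → ℝ → Prop)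
    (hnonneg : ∀ s t r, R s t r → 0 ≤ r) (hsymm : ∀ s t r, R s t r → R t s r)
    (hstep : ∀ e : X → X → ℝ, UnitValued e → (∀ x y, e x y ≤ d x y) →
      (∀ s t r, R s t r → e s t ≤ r) →
      ∀ s t r, R s t r → r < 1 → SimulatesUpTo T lam e s t r)
    {s t : X} {r : ℝ} (h : R s t r) : d s t ≤ r := by
  have hdB := hd.1
  -- Including `d x y` makes the set nonempty and keeps the infimum `e` below `d`, hence
  -- unit-valued. `e` itself need not satisfy the triangle inequality.
  let V : X → X → Set ℝ := fun x y => {r | r = d x y ∨ R x y r}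
  have hV0 : ∀ x y, ∀ r ∈ V x y, 0 ≤ r := by
    rintro x y r (rfl | hr)
    exacts [hdB.1.nonneg x y, hnonneg x y r hr]
  have hVne : ∀ x y, (V x y).Nonempty := fun x y => ⟨_, .inl rfl⟩
  have hVb : ∀ x y, BddBelow (V x y) := fun x y => ⟨0, hV0 x y⟩
  let e : X → X → ℝ := fun x y => sInf (V x y)
  have he0 : ∀ x y, 0 ≤ e x y := fun x y => le_csInf (hVne x y) (hV0 x y)
  have hed : ∀ x y, e x y ≤ d x y := fun x y => csInf_le (hVb x y) (.inl rfl)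
  have heR : ∀ s t r, R s t r → e s t ≤ r := fun s t r hr => csInf_le (hVb s t) (.inr hr)
  have heU : UnitValued e := fun x y => ⟨he0 x y, (hed x y).trans (hdB.1.le_one x y)⟩
  have hm := (isOneBoundedPseudometric_pseudometricBelow he0).unitValued
  have hB : IsBisimulationMetric T lam (pseudometricBelow e) := by
    refine isBisimulationMetric_pseudometricBelow hlam hT he0 fun x y => ?_
    refine le_csInf (hVne x y) fun r hr => ?_
    refine bisimStep_le (stepValues_mono hlam heU hm (pseudometricBelow_le he0) x y ?_)
    rcases hr with rfl | hr
    · exact stepValues_mono hlam hdB.1.unitValued heU hed x y (hdB.mem_stepValues x y)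
    · refine ⟨hnonneg x y r hr, (le_or_gt 1 r).imp_right fun hr1 => ?_⟩
      exact ⟨hstep e heU hed heR x y r hr hr1, hstep e heU hed heR y x r (hsymm x y r hr) hr1⟩
  -- Minimality of `d` against the metric just built below `R`.
  exact (hd.2 hB s t).trans ((pseudometricBelow_le he0 s t).trans (heR s t r h))

/-- The bisimilarity metric is a fixed point of the bisimulation game. -/
theorem IsBisimilarityMetric.le_of_simulatesUpTo (hlam : 0 < lam)
    (hT : ∀ t a, {π | T t a π}.Finite) (hd : IsBisimilarityMetric T lam d) {s t : X} {r : ℝ}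
    (hr : 0 ≤ r) (h : r < 1 → SimulatesUpTo T lam d s t r ∧ SimulatesUpTo T lam d t s r) :
    d s t ≤ r := by
  -- The relation contains the single pair in both orders; its own bound is not needed after the
  -- step, since `e ≤ d` suffices.
  refine hd.le_of_coinduction hlam hT (fun x y r' => (x = s ∧ y = t ∨ x = t ∧ y = s) ∧ r' = r)
    ?_ ?_ ?_ ⟨.inl ⟨rfl, rfl⟩, rfl⟩
  · rintro x y r' ⟨-, rfl⟩
    exact hr
  · rintro x y r' ⟨h', h''⟩
    exact ⟨h'.symm.imp And.symm And.symm, h''⟩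
  · rintro e he hed - x y r' ⟨⟨rfl, rfl⟩ | ⟨rfl, rfl⟩, rfl⟩ hr1
    exacts [(h hr1).1.mono hlam hd.1.1.unitValued he hed le_rfl,
      (h hr1).2.mono hlam hd.1.1.unitValued he hed le_rfl]

end Bisimilarity

/-- Every process has finitely many transitions with a given label. -/
theorem PTSS.finite_inducedModel {S : Signature.{u}} {A : Type v} (P : PTSS S A) (t : CTerm S)
    (a : A) : {π | P.inducedModel t a π}.Finite := by
  induction t generalizing a with
  | var x => exact x.elim
  | app f ts ih =>
    refine ((P.finite_rules f a).biUnion fun r _ => Set.Finite.image (fun ρ => r.target.eval ts ρ)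
      (Set.Finite.pi' fun j => ih (r.posVar j) (r.posAct j))).subset ?_
    intro π hπ
    rw [Set.mem_ofPred_eq, PTSS.inducedModel] at hπ
    obtain ⟨r, hr, ρ, h, -, rfl⟩ := hπ
    exact Set.mem_biUnion hr ⟨ρ, h, rfl⟩

/-! ## Transitions of the process algebra -/

section Transitions

variable {A : Type v} {S : Signature.{u}} (P : PTSS S A) (ι : SigInclusion (paSig A) S)

theorem opPMF_two (f : S.Op 2) (μ ν : PMF (CTerm S)) :
    opPMF f ![μ, ν] = μ.bind fun x => ν.map fun y => .app f ![x, y] := by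
  simp only [opPMF, prodPMF, PMF.pure_map, PMF.map_bind]
  rfl

theorem opPMF_pure_right (f : S.Op 2) (μ : PMF (CTerm S)) (y : CTerm S) :
    opPMF f ![μ, PMF.pure y] = μ.map fun u => .app f ![u, y] := by
  simp only [opPMF_two, PMF.pure_map]
  exact PMF.bind_pure_comp _ _

theorem opPMF_pure_left (f : S.Op 2) (x : CTerm S) (ν : PMF (CTerm S)) :
    opPMF f ![PMF.pure x, ν] = ν.map fun u => .app f ![x, u] := by
  simp only [opPMF_two, PMF.pure_bind]

/-- The rule `r`, applied to the arguments `ts`, derives a transition to `π`. -/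
def Rule.Fires {n : ℕ} (r : Rule (paSig A) A n) (ts : Fin n → CTerm S) (π : PMF (CTerm S)) :
    Prop :=
  ∃ ρ : Fin r.numPos → PMF (CTerm S), (∀ j, P.inducedModel (ts (r.posVar j)) (r.posAct j) (ρ j)) ∧
    (∀ q ∈ r.neg, ∀ π', ¬ P.inducedModel (ts q.1) q.2 π') ∧ π = (r.target.lift ι).eval ts ρ

variable {P ι}

/-- Disjointness enters only here: an extension adds no rules for these operators, so their
transitions can be read off `paRules`. -/
theorem IsDisjointExtension.inducedModel_iff {tick : A}
    (hP : IsDisjointExtension ι (paSpec tick) P) {n : ℕ} (f : PAOp A n) (ts : Fin n → CTerm S)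
    (a : A) (π : PMF (CTerm S)) :
    P.inducedModel (.app (ι.map (S := paSig A) f) ts) a π ↔
      ∃ r ∈ paRules tick f a, r.Fires P ι ts π := by
  have h := hP n f a
  rw [PTSS.inducedModel, h, Set.exists_mem_image]
  rfl

theorem fires_rule₀ {n : ℕ} (θ : DTerm (paSig A) (Fin n) (Fin 0)) (ts : Fin n → CTerm S)
    (π : PMF (CTerm S)) : (rule₀ θ).Fires P ι ts π ↔ π = (θ.lift ι).eval ts ![] := by
  constructor
  · rintro ⟨ρ, -, -, h⟩
    rwa [Subsingleton.elim ![] ρ]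
  · intro h
    exact ⟨![], fun j => j.elim0, by simp [rule₀], h⟩

theorem fires_rule₁ {n : ℕ} (i : Fin n) (a : A) (θ : DTerm (paSig A) (Fin n) (Fin 1))
    (ts : Fin n → CTerm S) (π : PMF (CTerm S)) :
    (rule₁ i a θ).Fires P ι ts π ↔
      ∃ μ, P.inducedModel (ts i) a μ ∧ π = (θ.lift ι).eval ts ![μ] := by
  constructor
  · rintro ⟨(ρ : Fin 1 → PMF (CTerm S)), h, -, h'⟩
    -- Both functions list to definitionally equal lists, and `List.ofFn` is injective.
    have hρ : ρ = ![ρ 0] := List.ofFn_inj.mp rfl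
    exact ⟨ρ 0, h (0 : Fin 1), hρ ▸ h'⟩
  · rintro ⟨μ, h, h'⟩
    exact ⟨![μ], Fin.forall_fin_one.2 h, by simp [rule₁], h'⟩

theorem fires_rule₂ {n : ℕ} (i : Fin n) (a : A) (j : Fin n) (b : A)
    (θ : DTerm (paSig A) (Fin n) (Fin 2)) (ts : Fin n → CTerm S) (π : PMF (CTerm S)) :
    (rule₂ i a j b θ).Fires P ι ts π ↔
      ∃ μ ν, P.inducedModel (ts i) a μ ∧ P.inducedModel (ts j) b ν ∧
        π = (θ.lift ι).eval ts ![μ, ν] := by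
  constructor
  · rintro ⟨(ρ : Fin 2 → PMF (CTerm S)), h, -, h'⟩
    have hρ : ρ = ![ρ 0, ρ 1] := List.ofFn_inj.mp rfl
    exact ⟨ρ 0, ρ 1, h (0 : Fin 2), h (1 : Fin 2), hρ ▸ h'⟩
  · rintro ⟨μ, ν, h, h', h''⟩
    exact ⟨![μ, ν], Fin.forall_fin_two.2 ⟨h, h'⟩, by simp [rule₂], h''⟩

theorem exists_mem_provided {R : Type*} {c : Prop} {r : R} {q : R → Prop} :
    (∃ r' ∈ provided c r, q r') ↔ c ∧ q r := by
  simp [provided, and_assoc]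

/-! ### Evaluation of lifted distribution terms. -/

variable {Vs Vd : Type} (σ : Vs → CTerm S) (ρ : Vd → PMF (CTerm S))

theorem eval_lift_var (m : Vd) : ((DTerm.var m : DTerm (paSig A) Vs Vd).lift ι).eval σ ρ = ρ m :=
  rfl

theorem eval_lift_paDirac (x : Vs) :
    ((paDirac x : DTerm (paSig A) Vs Vd).lift ι).eval σ ρ = PMF.pure (σ x) :=
  rfl

theorem eval_lift_paDirac₁ (f : PAOp A 1) (x : Vs) :
    ((paDirac₁ f x : DTerm (paSig A) Vs Vd).lift ι).eval σ ρ =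
      PMF.pure (.app (ι.map (S := paSig A) f) ![σ x]) := by
  simp only [paDirac₁, DTerm.lift, DTerm.eval, Term.lift, Term.subst]
  congr 2
  funext i
  rw [Subsingleton.elim i 0]
  rfl

theorem eval_lift_paStop :
    ((paStop : DTerm (paSig A) Vs Vd).lift ι).eval σ ρ =
      PMF.pure (.app (ι.map (S := paSig A) .nil) ![]) := by
  simp only [paStop, DTerm.lift, DTerm.eval, Term.lift, Term.subst]
  congr 2
  exact Subsingleton.elim _ _

theorem eval_lift_paBin (f : PAOp A 2) (θ₁ θ₂ : DTerm (paSig A) Vs Vd) :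
    ((paBin f θ₁ θ₂).lift ι).eval σ ρ =
      opPMF (ι.map (S := paSig A) f) ![(θ₁.lift ι).eval σ ρ, (θ₂.lift ι).eval σ ρ] := by
  simp only [paBin, DTerm.lift, DTerm.eval]
  congr 1
  funext i
  fin_cases i <;> rfl

theorem eval_lift_conv {I : Type} (p : PMF I) (hp : ∀ i, p i ≠ 0) (θ : I → DTerm (paSig A) Vs Vd) :
    ((DTerm.conv p hp θ).lift ι).eval σ ρ = p.bind fun i => ((θ i).lift ι).eval σ ρ :=
  rfl

/-- A unary operator of the process algebra, applied to a process. -/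
def SigInclusion.un (ι : SigInclusion (paSig A) S) (f : PAOp A 1) (x : CTerm S) : CTerm S :=
  .app (ι.map (S := paSig A) f) ![x]

/-- A binary operator of the process algebra, applied to two processes. -/
def SigInclusion.bin (ι : SigInclusion (paSig A) S) (f : PAOp A 2) (x y : CTerm S) : CTerm S :=
  .app (ι.map (S := paSig A) f) ![x, y]

/-- The stopped process. -/
def SigInclusion.inaction (ι : SigInclusion (paSig A) S) : CTerm S :=
  .app (ι.map (S := paSig A) .nil) ![]

end Transitions

/-! ### Operational characterisation of the operators involved. -/

section Operators

variable {A : Type v} {S : Signature.{u}} {P : PTSS S A} {ι : SigInclusion (paSig A) S} {tick : A}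
  (hP : IsDisjointExtension ι (paSpec tick) P)

include hP

theorem inducedModel_seq {x y : CTerm S} {a : A} {π : PMF (CTerm S)} :
    P.inducedModel (ι.bin .seq x y) a π ↔
      (a ≠ tick ∧ ∃ μ, P.inducedModel x a μ ∧ π = μ.map fun u => ι.bin .seq u y) ∨
      ∃ μ ν, P.inducedModel x tick μ ∧ P.inducedModel y a ν ∧ π = ν := by
  rw [SigInclusion.bin, hP.inducedModel_iff]
  simp only [paRules, Set.mem_union, or_and_right, exists_or, exists_mem_provided,
    Set.mem_singleton_iff, exists_eq_left, fires_rule₁, fires_rule₂, eval_lift_paBin,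
    eval_lift_var, eval_lift_paDirac, opPMF_pure_right]
  rfl

theorem inducedModel_par {x y : CTerm S} {a : A} {π : PMF (CTerm S)} :
    P.inducedModel (ι.bin .par x y) a π ↔
      ((a ≠ tick ∧ ∃ μ, P.inducedModel x a μ ∧ π = μ.map fun u => ι.bin .par u y) ∨
      (a ≠ tick ∧ ∃ ν, P.inducedModel y a ν ∧ π = ν.map fun u => ι.bin .par x u)) ∨
      (a = tick ∧ ∃ μ ν, P.inducedModel x tick μ ∧ P.inducedModel y tick ν ∧
        π = PMF.pure ι.inaction) := by
  rw [SigInclusion.bin, hP.inducedModel_iff]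
  simp only [paRules, Set.mem_union, or_and_right, exists_or, exists_mem_provided,
    fires_rule₁, fires_rule₂, eval_lift_paBin, eval_lift_paStop,
    eval_lift_var, eval_lift_paDirac]
  simp only [Matrix.cons_val_fin_one, opPMF_pure_right, opPMF_pure_left]
  rfl

theorem inducedModel_iter_zero {x : CTerm S} {a : A} {π : PMF (CTerm S)} :
    P.inducedModel (ι.un (.iter 0) x) a π ↔ a = tick ∧ π = PMF.pure ι.inaction := by
  rw [SigInclusion.un, hP.inducedModel_iff]
  simp only [paRules, exists_mem_provided, fires_rule₀, eval_lift_paStop]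
  rfl

theorem inducedModel_iter_succ {n : ℕ} {x : CTerm S} {a : A} {π : PMF (CTerm S)} :
    P.inducedModel (ι.un (.iter (n + 1)) x) a π ↔
      ((a ≠ tick ∧ ∃ μ, P.inducedModel x a μ ∧
        π = μ.map fun u => ι.bin .seq u (ι.un (.iter n) x)) ∨
      (a = tick ∧ ∃ μ, P.inducedModel x tick μ ∧ π = μ)) ∨
      ∃ m < n + 1, a ≠ tick ∧ ∃ μ ν, P.inducedModel x tick μ ∧ P.inducedModel x a ν ∧
        π = ν.map fun u => ι.bin .seq u (ι.un (.iter m) x) := by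
  rw [SigInclusion.un, hP.inducedModel_iff]
  have hU : ∀ q : Rule (paSig A) A 1 → Prop, (∃ r, (∃ m ∈ Finset.range (n + 1), r ∈
      provided (a ≠ tick) (rule₂ (0 : Fin 1) tick 0 a
        (paBin .seq (.var 1) (paDirac₁ (.iter m) 0)))) ∧ q r) ↔
      ∃ m < n + 1, a ≠ tick ∧ q (rule₂ 0 tick 0 a
        (paBin .seq (.var 1) (paDirac₁ (.iter m) 0))) := by
    intro q
    constructor
    · rintro ⟨r, ⟨m, hm, hr, rfl⟩, hq⟩
      exact ⟨m, Finset.mem_range.1 hm, hr, hq⟩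
    · rintro ⟨m, hm, hr, hq⟩
      exact ⟨_, ⟨m, Finset.mem_range.2 hm, hr, rfl⟩, hq⟩
  simp only [paRules, Set.mem_union, or_and_right, exists_or, exists_mem_provided, Set.mem_iUnion,
    exists_prop, hU, fires_rule₁, fires_rule₂, eval_lift_paBin, eval_lift_var, eval_lift_paDirac₁,
    opPMF_pure_right]
  rfl

theorem inducedModel_repl_zero {x : CTerm S} {a : A} {π : PMF (CTerm S)} :
    P.inducedModel (ι.un (.repl 0) x) a π ↔ a = tick ∧ π = PMF.pure ι.inaction := by
  rw [SigInclusion.un, hP.inducedModel_iff]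
  simp only [paRules, exists_mem_provided, fires_rule₀, eval_lift_paStop]
  rfl

theorem inducedModel_repl_succ {n : ℕ} {x : CTerm S} {a : A} {π : PMF (CTerm S)} :
    P.inducedModel (ι.un (.repl (n + 1)) x) a π ↔
      (a ≠ tick ∧ ∃ μ, P.inducedModel x a μ ∧
        π = μ.map fun u => ι.bin .par u (ι.un (.repl n) x)) ∨
      (a = tick ∧ ∃ μ, P.inducedModel x tick μ ∧ π = μ) := by
  rw [SigInclusion.un, hP.inducedModel_iff]
  simp only [paRules, Set.mem_union, or_and_right, exists_or, exists_mem_provided, fires_rule₁,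
    eval_lift_paBin, eval_lift_var, eval_lift_paDirac₁, opPMF_pure_right]
  rfl

theorem inducedModel_pbang {p : Prob} {x : CTerm S} {a : A} {π : PMF (CTerm S)} :
    P.inducedModel (ι.un (.pbang p) x) a π ↔
      a ≠ tick ∧ ∃ μ, P.inducedModel x a μ ∧ π = p.pmf.bind fun b =>
        if b then μ else μ.map fun u => ι.bin .par u (ι.un (.pbang p) x) := by
  rw [SigInclusion.un, hP.inducedModel_iff]
  have hmix (ts : Fin 1 → CTerm S) (μ : PMF (CTerm S)) :
      (((DTerm.var 0).mix p (paBin .par (.var 0) (paDirac₁ (.pbang p) 0)) :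
        DTerm (paSig A) (Fin 1) (Fin 1)).lift ι).eval ts ![μ] = p.pmf.bind fun b =>
        if b then μ else μ.map fun u => ι.bin .par u (ι.un (.pbang p) (ts 0)) := by
    rw [DTerm.mix, eval_lift_conv]
    congr 1
    funext b
    cases b
    · simp only [Bool.false_eq_true, if_false, eval_lift_paBin, eval_lift_var, eval_lift_paDirac₁,
        opPMF_pure_right]
      rfl
    · rfl
  simp only [paRules, exists_mem_provided, fires_rule₁, hmix]
  rfl

/-! ## Lipschitz continuity -/

variable {lam : ℝ} (hlam : lam ∈ Set.Ioc (0 : ℝ) 1) {d : CTerm S → CTerm S → ℝ}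
  (hd : IsBisimilarityMetric P.inducedModel lam d)

include hlam hd

/-- Coinduction over all pairs of sequential compositions. If the first component moves, the second
stays put and contributes at most `lam * d y y'`; if it terminates, only the step of the second
counts. -/
theorem dist_seq_le (x y x' y' : CTerm S) :
    d (ι.bin .seq x y) (ι.bin .seq x' y') ≤ d x x' + d y y' := by
  have hm := hd.1.1
  refine hd.le_of_coinduction hlam.1 P.finite_inducedModel (fun s t r => ∃ x y x' y',
    s = ι.bin .seq x y ∧ t = ι.bin .seq x' y' ∧ r = d x x' + d y y') ?_ ?_ ?_
    ⟨x, y, x', y', rfl, rfl, rfl⟩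
  · rintro s t r ⟨x, y, x', y', rfl, rfl, rfl⟩
    exact add_nonneg (hm.nonneg _ _) (hm.nonneg _ _)
  · rintro s t r ⟨x, y, x', y', rfl, rfl, rfl⟩
    exact ⟨x', y', x, y, rfl, rfl, by rw [hm.symm x, hm.symm y]⟩
  · rintro e he hed heR s t r ⟨x, y, x', y', rfl, rfl, rfl⟩ hr a π hπ
    have hx0 := hm.nonneg x x'
    have hy0 := hm.nonneg y y'
    have hx := hd.1.simulatesUpTo (t := x) (t' := x') (by linarith)
    have hy := hd.1.simulatesUpTo (t := y) (t' := y') (by linarith)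
    rcases (inducedModel_seq hP).1 hπ with ⟨ha, μ, hμ, rfl⟩ | ⟨μ, ν, hμ, hν, rfl⟩
    · obtain ⟨μ', hμ', hle⟩ := hx a μ hμ
      refine ⟨_, (inducedModel_seq hP).2 (.inl ⟨ha, μ', hμ', rfl⟩), ?_⟩
      have h := kantorovich_map_le hm.unitValued he hy0 (fun u => ι.bin .seq u y)
        (fun u => ι.bin .seq u y') (fun u u' => heR _ _ _ ⟨u, y, u', y', rfl, rfl, rfl⟩) μ μ'
      nlinarith [mul_le_mul_of_nonneg_left h hlam.1.le, mul_le_mul_of_nonneg_right hlam.2 hy0]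
    · obtain ⟨μ', hμ', -⟩ := hx tick μ hμ
      obtain ⟨ν', hν', hle⟩ := hy a π hν
      refine ⟨_, (inducedModel_seq hP).2 (.inr ⟨μ', ν', hμ', hν', rfl⟩), ?_⟩
      linarith [mul_le_mul_of_nonneg_left (kantorovich_mono hm.unitValued he hed π ν') hlam.1.le]

theorem dist_par_le (x y x' y' : CTerm S) :
    d (ι.bin .par x y) (ι.bin .par x' y') ≤ d x x' + d y y' := by
  have hm := hd.1.1
  refine hd.le_of_coinduction hlam.1 P.finite_inducedModel (fun s t r => ∃ x y x' y',
    s = ι.bin .par x y ∧ t = ι.bin .par x' y' ∧ r = d x x' + d y y') ?_ ?_ ?_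
    ⟨x, y, x', y', rfl, rfl, rfl⟩
  · rintro s t r ⟨x, y, x', y', rfl, rfl, rfl⟩
    exact add_nonneg (hm.nonneg _ _) (hm.nonneg _ _)
  · rintro s t r ⟨x, y, x', y', rfl, rfl, rfl⟩
    exact ⟨x', y', x, y, rfl, rfl, by rw [hm.symm x, hm.symm y]⟩
  · rintro e he hed heR s t r ⟨x, y, x', y', rfl, rfl, rfl⟩ hr a π hπ
    have hx0 := hm.nonneg x x'
    have hy0 := hm.nonneg y y'
    have hx := hd.1.simulatesUpTo (t := x) (t' := x') (by linarith)
    have hy := hd.1.simulatesUpTo (t := y) (t' := y') (by linarith)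
    rcases (inducedModel_par hP).1 hπ with
      (⟨ha, μ, hμ, rfl⟩ | ⟨ha, ν, hν, rfl⟩) | ⟨ha, μ, ν, hμ, hν, rfl⟩
    · obtain ⟨μ', hμ', hle⟩ := hx a μ hμ
      refine ⟨_, (inducedModel_par hP).2 (.inl (.inl ⟨ha, μ', hμ', rfl⟩)), ?_⟩
      have h := kantorovich_map_le hm.unitValued he hy0 (fun u => ι.bin .par u y)
        (fun u => ι.bin .par u y') (fun u u' => heR _ _ _ ⟨u, y, u', y', rfl, rfl, rfl⟩) μ μ'
      nlinarith [mul_le_mul_of_nonneg_left h hlam.1.le, mul_le_mul_of_nonneg_right hlam.2 hy0]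
    · obtain ⟨ν', hν', hle⟩ := hy a ν hν
      refine ⟨_, (inducedModel_par hP).2 (.inl (.inr ⟨ha, ν', hν', rfl⟩)), ?_⟩
      -- Now the second component moves, so the idle cost is `d x x'`.
      have h := kantorovich_map_le hm.unitValued he hx0 (fun u => ι.bin .par x u)
        (fun u => ι.bin .par x' u)
        (fun u u' => heR _ _ _ ⟨x, u, x', u', rfl, rfl, add_comm _ _⟩) ν ν'
      nlinarith [mul_le_mul_of_nonneg_left h hlam.1.le, mul_le_mul_of_nonneg_right hlam.2 hx0]
    · obtain ⟨μ', hμ', -⟩ := hx tick μ hμ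
      obtain ⟨ν', hν', -⟩ := hy tick ν hν
      refine ⟨_, (inducedModel_par hP).2 (.inr ⟨ha, μ', ν', hμ', hν', rfl⟩), ?_⟩
      -- Both targets are `δ(0)`. As `e` is not assumed reflexive, their distance is bounded through
      -- `d`.
      have h := kantorovich_mono hm.unitValued he hed (PMF.pure ι.inaction) (PMF.pure ι.inaction)
      rw [kantorovich_self hm] at h
      nlinarith [mul_le_mul_of_nonneg_left h hlam.1.le]

omit hP in
/-- Coupling the first arguments of `f`, where `f` is non-expansive. -/
theorem mul_kantorovich_map_bin_le {f : PAOp A 2}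
    (hf : ∀ x y x' y', d (ι.bin f x y) (ι.bin f x' y') ≤ d x x' + d y y') {y y' : CTerm S}
    {r s : ℝ} (hy : d y y' ≤ s) {μ μ' : PMF (CTerm S)} (h : lam * kantorovich d μ μ' ≤ r) :
    lam * kantorovich d (μ.map fun u => ι.bin f u y) (μ'.map fun u => ι.bin f u y') ≤ r + s := by
  have hm := hd.1.1
  have hy0 := hm.nonneg y y'
  have h' := kantorovich_map_le hm.unitValued hm.unitValued hy0 (fun u => ι.bin f u y)
    (fun u => ι.bin f u y') (fun u u' => hf u y u' y') μ μ'
  nlinarith [mul_le_mul_of_nonneg_left h' hlam.1.le, mul_le_mul_of_nonneg_right hlam.2 hy0]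

/-- Strong induction is needed because a process that can terminate may skip ahead to any smaller
iteration count `m`; the bound for `m` is dominated by that for `n`. -/
theorem dist_iter_le (n : ℕ) (x y : CTerm S) :
    d (ι.un (.iter n) x) (ι.un (.iter n) y) ≤ n * d x y := by
  have hm := hd.1.1
  induction n using Nat.strong_induction_on generalizing x y with
  | _ n ih =>
  suffices h : ∀ x y, n * d x y < 1 → SimulatesUpTo P.inducedModel lam d (ι.un (.iter n) x)
      (ι.un (.iter n) y) (n * d x y) from
    hd.le_of_simulatesUpTo hlam.1 P.finite_inducedModel
      (mul_nonneg n.cast_nonneg (hm.nonneg x y))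
      fun h1 => ⟨h x y h1, hm.symm y x ▸ h y x (hm.symm x y ▸ h1)⟩
  intro x y h1 a π hπ
  have h0 := hm.nonneg x y
  cases n with
  | zero =>
    -- With factor `0` nothing gives `d x y < 1`, but the rule has no premises, so no simulation is
    -- needed.
    obtain ⟨ha, rfl⟩ := (inducedModel_iter_zero hP).1 hπ
    exact ⟨_, (inducedModel_iter_zero hP).2 ⟨ha, rfl⟩, by simp [kantorovich_self hm]⟩
  | succ n =>
    push_cast at h1 ⊢
    have hn : 0 ≤ (n : ℝ) * d x y := by positivity
    have hxy := hd.1.simulatesUpTo (t := x) (t' := y) (by linarith)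
    rcases (inducedModel_iter_succ hP).1 hπ with
      (⟨ha, μ, hμ, rfl⟩ | ⟨ha, μ, hμ, rfl⟩) | ⟨m, hmn, ha, μ, ν, hμ, hν, rfl⟩
    · obtain ⟨μ', hμ', hle⟩ := hxy a μ hμ
      refine ⟨_, (inducedModel_iter_succ hP).2 (.inl (.inl ⟨ha, μ', hμ', rfl⟩)), ?_⟩
      have := mul_kantorovich_map_bin_le hlam hd (dist_seq_le hP hlam hd)
        (ih n n.lt_succ_self x y) hle
      linarith
    · obtain ⟨μ', hμ', hle⟩ := hxy tick π hμ
      exact ⟨_, (inducedModel_iter_succ hP).2 (.inl (.inr ⟨ha, μ', hμ', rfl⟩)), by linarith⟩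
    · obtain ⟨μ', hμ', -⟩ := hxy tick μ hμ
      obtain ⟨ν', hν', hle⟩ := hxy a ν hν
      refine ⟨_, (inducedModel_iter_succ hP).2 (.inr ⟨m, hmn, ha, μ', ν', hμ', hν', rfl⟩), ?_⟩
      have := mul_kantorovich_map_bin_le hlam hd (dist_seq_le hP hlam hd) (ih m hmn x y) hle
      have hmn' : (m : ℝ) * d x y ≤ n * d x y := by
        gcongr
        exact Nat.lt_succ_iff.1 hmn
      linarith

theorem dist_repl_le (n : ℕ) (x y : CTerm S) :
    d (ι.un (.repl n) x) (ι.un (.repl n) y) ≤ n * d x y := by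
  have hm := hd.1.1
  induction n generalizing x y with
  | zero =>
    have h : ∀ x y, SimulatesUpTo P.inducedModel lam d (ι.un (.repl 0) x) (ι.un (.repl 0) y) 0 := by
      intro x y a π hπ
      obtain ⟨ha, rfl⟩ := (inducedModel_repl_zero hP).1 hπ
      exact ⟨_, (inducedModel_repl_zero hP).2 ⟨ha, rfl⟩, by simp [kantorovich_self hm]⟩
    simpa using hd.le_of_simulatesUpTo hlam.1 P.finite_inducedModel le_rfl fun _ => ⟨h x y, h y x⟩
  | succ n ih =>
    suffices h : ∀ x y, (n + 1) * d x y < 1 → SimulatesUpTo P.inducedModel lam d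
        (ι.un (.repl (n + 1)) x) (ι.un (.repl (n + 1)) y) ((n + 1) * d x y) by
      push_cast
      exact hd.le_of_simulatesUpTo hlam.1 P.finite_inducedModel
        (mul_nonneg (by positivity) (hm.nonneg x y))
        fun h1 => ⟨h x y h1, hm.symm y x ▸ h y x (hm.symm x y ▸ h1)⟩
    intro x y h1 a π hπ
    have h0 := hm.nonneg x y
    have hn : 0 ≤ (n : ℝ) * d x y := by positivity
    have hxy := hd.1.simulatesUpTo (t := x) (t' := y) (by linarith)
    rcases (inducedModel_repl_succ hP).1 hπ with ⟨ha, μ, hμ, rfl⟩ | ⟨ha, μ, hμ, rfl⟩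
    · obtain ⟨μ', hμ', hle⟩ := hxy a μ hμ
      refine ⟨_, (inducedModel_repl_succ hP).2 (.inl ⟨ha, μ', hμ', rfl⟩), ?_⟩
      have := mul_kantorovich_map_bin_le hlam hd (dist_par_le hP hlam hd) (ih x y) hle
      linarith
    · obtain ⟨μ', hμ', hle⟩ := hxy tick π hμ
      exact ⟨_, (inducedModel_repl_succ hP).2 (.inr ⟨ha, μ', hμ', rfl⟩), by linarith⟩

/-- With weight `p` the targets are `μ`, `μ'`; with weight `1 - p` they also carry a copy of the
bang, adding its distance by `dist_par_le`. The discount applies to both branches. -/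
theorem dist_pbang_le_add (p : Prob) (x y : CTerm S) :
    d (ι.un (.pbang p) x) (ι.un (.pbang p) y) ≤
      d x y + (1 - p.1) * lam * d (ι.un (.pbang p) x) (ι.un (.pbang p) y) := by
  have hm := hd.1.1
  have hq : 0 ≤ 1 - p.1 := sub_nonneg.2 p.2.2.le
  have hr (x y : CTerm S) :
      0 ≤ (1 - p.1) * lam * d (ι.un (.pbang p) x) (ι.un (.pbang p) y) :=
    mul_nonneg (mul_nonneg hq hlam.1.le) (hm.nonneg _ _)
  suffices h : ∀ x y, d x y < 1 → SimulatesUpTo P.inducedModel lam d (ι.un (.pbang p) x)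
      (ι.un (.pbang p) y)
      (d x y + (1 - p.1) * lam * d (ι.un (.pbang p) x) (ι.un (.pbang p) y)) by
    refine hd.le_of_simulatesUpTo hlam.1 P.finite_inducedModel
      (add_nonneg (hm.nonneg x y) (hr x y)) fun h1 => ⟨h x y (by linarith [hr x y]), ?_⟩
    have := h y x (by linarith [hr x y, hm.symm x y])
    rwa [hm.symm y x, hm.symm (ι.un (.pbang p) y)] at this
  intro x y h1 a π hπ
  obtain ⟨ha, μ, hμ, rfl⟩ := (inducedModel_pbang hP).1 hπ
  obtain ⟨μ', hμ', hle⟩ := hd.1.simulatesUpTo h1 a μ hμ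
  refine ⟨_, (inducedModel_pbang hP).2 ⟨ha, μ', hμ', rfl⟩, ?_⟩
  have hmix := kantorovich_mix_le hm.unitValued p
    (fun b => if b then μ else μ.map fun u => ι.bin .par u (ι.un (.pbang p) x))
    (fun b => if b then μ' else μ'.map fun u => ι.bin .par u (ι.un (.pbang p) y))
  have hpar := kantorovich_map_le hm.unitValued hm.unitValued (hm.nonneg _ _)
    (fun u => ι.bin .par u (ι.un (.pbang p) x)) (fun u => ι.bin .par u (ι.un (.pbang p) y))
    (fun u u' => dist_par_le hP hlam hd u _ u' _) μ μ'
  simp only [if_true, Bool.false_eq_true, if_false] at hmix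
  -- The two branch costs recombine, since `p * K + (1 - p) * (K + D) = K + (1 - p) * D`.
  refine (mul_le_mul_of_nonneg_left (hmix.trans
    (add_le_add_right (mul_le_mul_of_nonneg_left hpar hq) _)) hlam.1.le).trans ?_
  linarith

/-- Solves the self-referential inequality; `p > 0` makes the denominator positive even when `lam =
1`. -/
theorem dist_pbang_le (p : Prob) (x y : CTerm S) :
    d (ι.un (.pbang p) x) (ι.un (.pbang p) y) ≤ 1 / (1 - (1 - p.1) * lam) * d x y := by
  have hC : 0 < 1 - (1 - p.1) * lam := by nlinarith [p.2.1, p.2.2, hlam.1, hlam.2]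
  rw [one_div_mul_eq_div, le_div_iff₀ hC]
  linarith [dist_pbang_le_add hP hlam hd p x y]

end Operators

theorem isLipschitzOperator_un {A : Type v} {S : Signature.{u}} {ι : SigInclusion (paSig A) S}
    {d : CTerm S → CTerm S → ℝ} {f : PAOp A 1} {K : ℝ} (hK : 0 ≤ K)
    (h : ∀ x y, d (ι.un f x) (ι.un f y) ≤ K * d x y) :
    IsLipschitzOperator d (ι.map (S := paSig A) f) K := by
  refine ⟨hK, fun s t => ?_⟩
  have hs (s : Fin 1 → CTerm S) : s = ![s 0] := List.ofFn_inj.mp rfl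
  rw [Fin.sum_univ_one, hs s, hs t]
  exact h (s 0) (t 0)

theorem mainTheorem7 {A : Type v} (tick : A) {S : Signature.{u}} (P : PTSS S A)
    (ι : SigInclusion (paSig A) S) (hP : IsDisjointExtension ι (paSpec tick) P)
    (lam : ℝ) (hlam : lam ∈ Set.Ioc (0 : ℝ) 1) :
    ∃ d : CTerm S → CTerm S → ℝ, IsBisimilarityMetric P.inducedModel lam d ∧
      (∀ n : ℕ, IsLipschitzOperator d (ι.map (PAOp.iter n)) n) ∧
      (∀ n : ℕ, IsLipschitzOperator d (ι.map (PAOp.repl n)) n) ∧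
      (∀ p : Prob, IsLipschitzOperator d (ι.map (PAOp.pbang p)) (1 / (1 - (1 - p.1) * lam))) := by
  obtain ⟨d, hd⟩ := exists_isBisimilarityMetric hlam.1 P.finite_inducedModel
  refine ⟨d, hd, fun n => isLipschitzOperator_un n.cast_nonneg (dist_iter_le hP hlam hd n),
    fun n => isLipschitzOperator_un n.cast_nonneg (dist_repl_le hP hlam hd n),
    fun p => isLipschitzOperator_un ?_ (dist_pbang_le hP hlam hd p)⟩
  have hC : 0 < 1 - (1 - p.1) * lam := by nlinarith [p.2.1, p.2.2, hlam.1, hlam.2]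
  positivity
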